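/- **Proposition (intertwining).** Let $n\ge 0$, $\hbar>0$, $\phi\in\mathcal S(\mathbb R^n)$. Write $z=(x,p)\in\mathbb R^{2n}=\mathbb R^n\times\mathbb R^n$, $z_0=(x_0,p_0)$, and let $\sigma(z,z')=p\cdot x'-p'\cdot x$ be the standard symplectic form. For $z_0\in\mathbb R^{2n}$, $\psi\in\mathcal S(\mathbb R^n)$, $\Psi\in\mathcal S(\mathbb R^{2n})$ put $$\widehat T(z_0)\psi(x)=e^{\frac i\hbar(p_0\cdot x-\frac12p_0\cdot x_0)}\psi(x-x_0),\qquad \widetilde T(z_0)\Psi(z)=e^{-\frac i\hbar\sigma(z,z_0)}\Psi(z-\tfrac12z_0),$$ $$W_\phi\psi(z)=\left(\tfrac1{2\pi\hbar}\right)^{n/2}\int_{\mathbb R^n}e^{-\frac i\hbar p\cdot y}\,\psi(x+\tfrac12y)\,\overline{\phi(x-\tfrac12y)}\,dy ,$$ that is, $W_\phi\psi=(2\pi\hbar)^{n/2}W(\psi,\phi)$ with $W(\psi,\phi)$ the cross-Wigner transform, and let $$W_\phi^*\Psi(x)=\left(\tfrac2{\pi\hbar}\right)^{n/2}\int_{\mathbb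 R^n}\int_{\mathbb R^n}e^{\frac{2i}\hbar p\cdot(x-y)}\,\phi(2y-x)\,\Psi(y,p)\,dp\,dy$$ be its $L^2$-adjoint. The operators $\widehat T(z_0)$, $\widetilde T(z_0)$, $W_\phi$ and $W_\phi^*$ map Schwartz functions to Schwartz functions and are extended to tempered distributions by duality with their $L^2$-adjoints: $\langle Au,\chi\rangle=\langle u,\overline{A^*\overline\chi}\rangle$. For $H\in\mathcal S'(\mathbb R^{2n})$ let $\widehat H:\mathcal S(\mathbb R^n)\to\mathcal S'(\mathbb R^n)$ be the Weyl operator with symbol $H$, that is, the operator with distributional kernel $$K(x,y)=\left(\tfrac1{2\pi\hbar}\right)^n\int_{\mathbb R^n}e^{\frac i\hbar p\cdot(x-y)}H(\tfrac12(x+y),p)\,dp,$$ and let $\widetilde H:\mathcal S(\mathbb R^{2n})\to\mathcal S'(\mathbb R^{2n})$, $\widetilde H\Psi=H\star\Psi$, be the Moyal product $$H\star\Psi(z)=\left(\tfrac1{4\pi\hbar}\right)^{2n}\iint e^{\frac i{2\hbar}\sigma(u,v)}\,H(z+\tfrac12u)\,\Psi(z-\tfrac12v)\,du\,dv$$ ($u,v\in\mathbb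 R^{2n}$; both formulas are understood in the sense of distributions when $H$ is not a Schwartz function). Then: (i) $W_\phi(\widehat T(z_0)\psi)=\widetilde T(z_0)W_\phi\psi$ for all $z_0\in\mathbb R^{2n}$ and all $\psi\in\mathcal S(\mathbb R^n)$, and more generally for all $\psi\in\mathcal S'(\mathbb R^n)$ (in particular for all $\psi\in L^2(\mathbb R^n)$); (ii) for every $H\in\mathcal S'(\mathbb R^{2n})$ one has $\widetilde HW_\phi=W_\phi\widehat H$ on $\mathcal S(\mathbb R^n)$ and $W_\phi^*\widetilde H=\widehat HW_\phi^*$ on $\mathcal S(\mathbb R^{2n})$. -/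

import Mathlib

open MeasureTheory SchwartzMap
open scoped SchwartzMap ContDiff ComplexConjugate Real

set_option linter.unusedSectionVars false

noncomputable section

namespace PhaseSpace

section FiberFourier

variable {X Y Z V : Type} [NormedAddCommGroup X] [NormedSpace ℝ X]
  [NormedAddCommGroup Y] [NormedSpace ℝ Y] [NormedAddCommGroup Z] [NormedSpace ℝ Z]
  [NormedAddCommGroup V] [NormedSpace ℝ V] [NormedSpace ℂ V]

/-- The kernel `exp (-i t)`. -/
def fiberChar (t : ℝ) : ℂ := Complex.exp (-(Complex.I * (t : ℂ)))

theorem norm_fiberChar_smul (t : ℝ) (v : V) : ‖fiberChar t • v‖ = ‖v‖ := by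
  rw [norm_smul]; simp [fiberChar, Complex.norm_exp]

theorem continuous_fiberChar : Continuous fiberChar := by
  unfold fiberChar; fun_prop

theorem hasDerivAt_fiberChar (t : ℝ) :
    HasDerivAt fiberChar (-(Complex.I * fiberChar t)) t := by
  have h : HasDerivAt (fun t : ℝ => -(Complex.I * (t : ℂ))) (-(Complex.I * 1)) t :=
    ((Complex.ofRealCLM.hasDerivAt (x := t)).const_mul Complex.I).neg
  refine h.cexp.congr_deriv ?_
  simp only [fiberChar]; ring

/-- Precomposition of a continuous linear map on `X × Y` with `(x, z) ↦ (x, 0)`. -/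
def fstPrecomp : (X × Y →L[ℝ] V) →L[ℂ] (X × Z →L[ℝ] V) :=
  LinearMap.mkContinuous
    ({toFun := fun A : X × Y →L[ℝ] V => A.comp ((ContinuousLinearMap.fst ℝ X Z).prod 0)
      map_add' := fun _ _ => by ext <;> simp
      map_smul' := fun _ _ => by ext <;> simp } :
      (X × Y →L[ℝ] V) →ₗ[ℂ] (X × Z →L[ℝ] V)) 1 (fun A => by
    rw [one_mul]
    refine ContinuousLinearMap.opNorm_le_bound _ (norm_nonneg _) fun z => ?_
    refine (A.le_opNorm _).trans ?_
    gcongr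
    simp [Prod.norm_def])

theorem fstPrecomp_apply (A : X × Y →L[ℝ] V) (w : X × Z) :
    (fstPrecomp A : X × Z →L[ℝ] V) w = A (w.1, 0) := rfl

variable (L : Y →L[ℝ] Z →L[ℝ] ℝ)

/-- The pairing `((x, y), (x', z)) ↦ L y z`. -/
def sndPairing : X × Y →L[ℝ] (X × Z) →L[ℝ] ℝ :=
  ((ContinuousLinearMap.compL ℝ (X × Z) Z ℝ).flip (ContinuousLinearMap.snd ℝ X Z)).comp
    (L.comp (ContinuousLinearMap.snd ℝ X Y))

theorem sndPairing_apply (w : X × Y) (z : X × Z) : sndPairing L w z = L w.2 z.2 := rfl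

/-- The Schwartz function whose fibrewise Fourier transform is the derivative of that of `F`. -/
def fiberDeriv : 𝓢(X × Y, V) →L[ℂ] 𝓢(X × Y, X × Z →L[ℝ] V) :=
  (postcompCLM fstPrecomp).comp (fderivCLM ℂ (X × Y) V)
    - Complex.I • smulRightCLM ℂ V (sndPairing L)

theorem fiberDeriv_apply (F : 𝓢(X × Y, V)) (w : X × Y) (v : X × Z) :
    fiberDeriv L F w v = fderiv ℝ F w (v.1, 0) - Complex.I • (L w.2 v.2 • F w) := rfl

variable [MeasureSpace Y]

/-- The fibrewise Fourier integral `(x, z) ↦ ∫ exp (-i L(y, z)) F(x, y) dy`. -/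
def fiberFourierFun (F : X × Y → V) (w : X × Z) : V :=
  ∫ y, fiberChar (L y w.2) • F (w.1, y)

variable [BorelSpace Y] [FiniteDimensional ℝ Y] [(volume : Measure Y).IsAddHaarMeasure]

theorem fiber_decay (j : ℕ) : ∃ (s : Finset (ℕ × ℕ)) (C : ℝ), 0 ≤ C ∧
    ∀ (F : 𝓢(X × Y, V)) (x : X) (y : Y), ‖x‖ ^ j * ‖F (x, y)‖ ≤
      C * s.sup (schwartzSeminormFamily ℂ (X × Y) V) F *
        (1 + ‖y‖) ^ (-((volume : Measure Y).integrablePower : ℝ)) := by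
  set N := (volume : Measure Y).integrablePower
  refine ⟨Finset.Iic (j + N, 0), 2 ^ (j + N), by positivity, fun F x y => ?_⟩
  have h := one_add_le_sup_seminorm_apply (𝕜 := ℂ) (m := (j + N, 0)) (k := j + N) (n := 0)
    le_rfl le_rfl F (x, y)
  rw [norm_iteratedFDeriv_zero] at h
  have hy : 0 < 1 + ‖y‖ := by positivity
  rw [Real.rpow_neg hy.le, Real.rpow_natCast, ← div_eq_mul_inv, le_div_iff₀ (by positivity)]
  refine le_trans ?_ h
  have h1 : ‖x‖ ≤ 1 + ‖(x, y)‖ := by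
    have := norm_fst_le (x, y); simp only at this; linarith
  have h2 : 1 + ‖y‖ ≤ 1 + ‖(x, y)‖ := by
    have := norm_snd_le (x, y); simp only at this; linarith
  calc ‖x‖ ^ j * ‖F (x, y)‖ * (1 + ‖y‖) ^ N = (‖x‖ ^ j * (1 + ‖y‖) ^ N) * ‖F (x, y)‖ := by ring
    _ ≤ ((1 + ‖(x, y)‖) ^ j * (1 + ‖(x, y)‖) ^ N) * ‖F (x, y)‖ := by gcongr
    _ = _ := by rw [pow_add]

theorem integrable_decay : Integrable
    (fun y : Y => (1 + ‖y‖) ^ (-((volume : Measure Y).integrablePower : ℝ))) :=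
  Measure.integrable_pow_neg_integrablePower _

theorem continuous_fiber (F : 𝓢(X × Y, V)) (w : X × Z) :
    Continuous fun y => fiberChar (L y w.2) • F (w.1, y) :=
  (continuous_fiberChar.comp (by fun_prop)).smul (F.continuous.comp (by fun_prop))

theorem integrable_fiber (F : 𝓢(X × Y, V)) (w : X × Z) :
    Integrable fun y => fiberChar (L y w.2) • F (w.1, y) := by
  obtain ⟨s, C, -, h⟩ := fiber_decay (X := X) (Y := Y) (V := V) 0
  refine (integrable_decay.const_mul (C * s.sup (schwartzSeminormFamily ℂ (X × Y) V) F)).mono'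
    (continuous_fiber L F w).aestronglyMeasurable (.of_forall fun y => ?_)
  rw [norm_fiberChar_smul]
  simpa using h F w.1 y

theorem hasFDerivAt_fiber (F : 𝓢(X × Y, V)) (y : Y) (w : X × Z) :
    HasFDerivAt (fun w : X × Z => fiberChar (L y w.2) • F (w.1, y))
      (fiberChar (L y w.2) • fiberDeriv L F (w.1, y)) w := by
  have h0 : HasFDerivAt (fun w : X × Z => L y w.2)
      ((L y).comp (ContinuousLinearMap.snd ℝ X Z)) w :=
    ((L y).comp (ContinuousLinearMap.snd ℝ X Z)).hasFDerivAt
  have h1 := (hasDerivAt_fiberChar (L y w.2)).hasFDerivAt.comp w h0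
  have h2 : HasFDerivAt (fun w : X × Z => F (w.1, y))
      ((fderiv ℝ F (w.1, y)).comp ((ContinuousLinearMap.fst ℝ X Z).prod 0)) w := by
    have h3 : HasFDerivAt (fun w : X × Z => (w.1, y))
      ((ContinuousLinearMap.fst ℝ X Z).prod 0) w :=
      hasFDerivAt_fst.prodMk (hasFDerivAt_const _ _)
    exact (F.hasFDerivAt (w.1, y)).comp w h3
  refine (h1.smul h2).congr_fderiv ?_
  refine ContinuousLinearMap.ext fun v => ?_
  have e : (fiberChar (L y w.2) • fiberDeriv L F (w.1, y)) v =
    fiberChar (L y w.2) • (fiberDeriv L F (w.1, y) v) := rfl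
  rw [e, fiberDeriv_apply]
  simp only [add_apply, smul_apply, ContinuousLinearMap.smulRight_apply,
    ContinuousLinearMap.comp_apply, ContinuousLinearMap.prod_apply, zero_apply,
    ContinuousLinearMap.coe_fst', ContinuousLinearMap.coe_snd', smul_sub, Function.comp_apply,
    ContinuousLinearMap.toSpanSingleton_apply]
  rw [sub_eq_add_neg]
  congr 1
  rw [← algebraMap_smul ℂ (L y v.2) (F (w.1, y)), smul_smul, smul_smul, ← neg_smul,
    Complex.real_smul, Complex.coe_algebraMap]
  congr 1
  ring

theorem hasFDerivAt_fiberFourierFun (F : 𝓢(X × Y, V)) (w : X × Z) :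
    HasFDerivAt (fiberFourierFun L F) (fiberFourierFun L (fiberDeriv L F) w) w := by
  obtain ⟨s, C, -, h⟩ := fiber_decay (X := X) (Y := Y) (V := X × Z →L[ℝ] V) 0
  have hb : ∀ (w : X × Z) (y : Y), ‖fiberChar (L y w.2) • fiberDeriv L F (w.1, y)‖ ≤
      C * s.sup (schwartzSeminormFamily ℂ (X × Y) _) (fiberDeriv L F) *
        (1 + ‖y‖) ^ (-((volume : Measure Y).integrablePower : ℝ)) := fun w y => by
    refine (norm_fiberChar_smul (V := X × Z →L[ℝ] V) _ _).trans_le ?_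
    simpa using h (fiberDeriv L F) w.1 y
  have h1 : ∀ w : X × Z, AEStronglyMeasurable
    (fun y => fiberChar (L y w.2) • F (w.1, y)) volume :=
      fun w => (continuous_fiber L F w).aestronglyMeasurable
  have h2 : AEStronglyMeasurable (fun y => fiberChar (L y w.2) • fiberDeriv L F (w.1, y)) volume :=
      (continuous_fiber L (fiberDeriv L F) w).aestronglyMeasurable
  have hi := (integrable_decay (Y := Y)).const_mul
    (C * s.sup (schwartzSeminormFamily ℂ (X × Y) _) (fiberDeriv L F))
  have hF := integrable_fiber L F w
  exact hasFDerivAt_integral_of_dominated_of_fderiv_le (μ := (volume : Measure Y)) (𝕜 := ℝ)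
    (s := Set.univ)
    (F := fun (w : X × Z) y => fiberChar (L y w.2) • F (w.1, y))
    (F' := fun w y => fiberChar (L y w.2) • fiberDeriv L F (w.1, y))
    Filter.univ_mem (Filter.Eventually.of_forall h1) hF h2
    (Filter.Eventually.of_forall fun y w _ => hb w y) hi
    (Filter.Eventually.of_forall fun y w _ => hasFDerivAt_fiber L F y w)


/-- Integration by parts in the fibre. -/
theorem fiberFourierFun_fderiv (F : 𝓢(X × Y, V)) (w : X × Z) (v : Y) :
    fiberFourierFun L (fderivCLM ℂ (X × Y) V F) w (0, v) =
      (Complex.I * (L v w.2 : ℂ)) • fiberFourierFun L F w := by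
  have hi := integrable_fiber L (fderivCLM ℂ (X × Y) V F) w
  have e1 : fiberFourierFun L (fderivCLM ℂ (X × Y) V F) w (0, v) =
      ∫ y, fiberChar (L y w.2) • fderiv ℝ F (w.1, y) (0, v) :=
    ContinuousLinearMap.integral_apply hi _
  have hg : ∀ y, HasFDerivAt (fun y => F (w.1, y))
      ((fderiv ℝ F (w.1, y)).comp ((0 : Y →L[ℝ] X).prod (ContinuousLinearMap.id ℝ Y))) y := by
    intro y
    have h3 : HasFDerivAt (fun y : Y => (w.1, y))
      ((0 : Y →L[ℝ] X).prod (ContinuousLinearMap.id ℝ Y)) y :=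
      (hasFDerivAt_const _ _).prodMk (hasFDerivAt_id _)
    exact (F.hasFDerivAt (w.1, y)).comp y h3
  have hf : ∀ y, HasFDerivAt (fun y => fiberChar (L y w.2))
      ((ContinuousLinearMap.toSpanSingleton ℝ (-(Complex.I * fiberChar (L y w.2)))).comp
        (L.flip w.2)) y := fun y => by
    have h0 : HasFDerivAt (fun y => L y w.2) (L.flip w.2) y := (L.flip w.2).hasFDerivAt
    exact (hasDerivAt_fiberChar (L y w.2)).hasFDerivAt.comp y h0
  have eg : ∀ y, fderiv ℝ (fun y => F (w.1, y)) y v = fderiv ℝ F (w.1, y) (0, v) := fun y => by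
    rw [(hg y).fderiv]; rfl
  have ef : ∀ y, fderiv ℝ (fun y => fiberChar (L y w.2)) y v =
      -(Complex.I * (L v w.2 : ℂ)) * fiberChar (L y w.2) := fun y => by
    rw [(hf y).fderiv]
    simp only [ContinuousLinearMap.comp_apply, ContinuousLinearMap.toSpanSingleton_apply,
      ContinuousLinearMap.flip_apply, Complex.real_smul]
    ring
  have hF := integrable_fiber L F w
  have hIBP := integral_smul_fderiv_eq_neg_fderiv_smul_of_integrable (μ := (volume : Measure Y))
    (f := fun y => fiberChar (L y w.2)) (g := fun y => F (w.1, y)) (v := v) ?_ ?_ hF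
    (fun y _ => (hf y).differentiableAt) (fun y _ => (hg y).differentiableAt)
  · simp only [eg, ef] at hIBP
    rw [e1, hIBP, ← integral_neg, fiberFourierFun, ← integral_smul]
    congr 1
    ext y
    rw [smul_smul, ← neg_smul]
    congr 1
    ring
  · simp only [ef, ← smul_smul]
    exact hF.smul (-(Complex.I * (L v w.2 : ℂ)))
  · simp only [eg]
    exact hi.apply_continuousLinearMap _

theorem decay_fiberFourierFun (hL : ∀ z, (∀ y, L y z = 0) → z = 0) [FiniteDimensional ℝ Z] (j k : ℕ) :
    ∀ (V : Type) [NormedAddCommGroup V] [NormedSpace ℝ V] [NormedSpace ℂ V],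
    ∃ (s : Finset (ℕ × ℕ)) (C : ℝ), 0 ≤ C ∧
    ∀ (F : 𝓢(X × Y, V)) (w : X × Z), ‖w.1‖ ^ j * ‖w.2‖ ^ k * ‖fiberFourierFun L F w‖ ≤
      C * s.sup (schwartzSeminormFamily ℂ (X × Y) V) F := by
  obtain ⟨K, hK, hL'⟩ := LinearMap.exists_antilipschitzWith (L.flip : Z →ₗ[ℝ] Y →L[ℝ] ℝ) (by
    refine (Submodule.eq_bot_iff _).2 fun z hz => hL z fun y => ?_
    exact congrArg (fun f : Y →L[ℝ] ℝ => f y) hz)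
  have hLK : ∀ z, ‖z‖ ≤ K * ‖L.flip z‖ := fun z => by simpa using hL'.le_mul_dist z 0
  induction k with
  | zero =>
    intro V _ _ _
    obtain ⟨s, C, hC, h⟩ := fiber_decay (X := X) (Y := Y) (V := V) j
    refine ⟨s, C * ∫ y : Y, (1 + ‖y‖) ^ (-((volume : Measure Y).integrablePower : ℝ)), ?_, ?_⟩
    · exact mul_nonneg hC (integral_nonneg fun y => by positivity)
    intro F w
    rw [pow_zero, mul_one]
    have h1 : ‖fiberFourierFun L F w‖ ≤ ∫ y, ‖F (w.1, y)‖ := by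
      refine (norm_integral_le_integral_norm _).trans_eq ?_
      simp only [norm_fiberChar_smul]
    have hi : Integrable fun y => ‖F (w.1, y)‖ := by
      refine (integrable_fiber L F w).norm.congr (.of_forall fun y => ?_)
      simp only [norm_fiberChar_smul]
    calc ‖w.1‖ ^ j * ‖fiberFourierFun L F w‖ ≤ ‖w.1‖ ^ j * ∫ y, ‖F (w.1, y)‖ := by gcongr
      _ = ∫ y, ‖w.1‖ ^ j * ‖F (w.1, y)‖ := by rw [integral_const_mul]
      _ ≤ ∫ y : Y, C * s.sup (schwartzSeminormFamily ℂ (X × Y) V) F *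
          (1 + ‖y‖) ^ (-((volume : Measure Y).integrablePower : ℝ)) :=
        integral_mono (hi.const_mul _) (integrable_decay.const_mul _) fun y => h F w.1 y
      _ = _ := by rw [integral_const_mul]; ring
  | succ k ih =>
    intro V _ _ _
    obtain ⟨s, C, hC, h⟩ := ih (X × Y →L[ℝ] V)
    obtain ⟨s', C', hC', h'⟩ := Seminorm.bound_of_continuous (schwartz_withSeminorms ℂ (X × Y) V)
      ((s.sup (schwartzSeminormFamily ℂ (X × Y) (X × Y →L[ℝ] V))).comp
        (fderivCLM ℂ (X × Y) V).toLinearMap) (by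
        have hc := ((schwartz_withSeminorms ℂ (X × Y) (X × Y →L[ℝ] V)).finset_sups.continuous_seminorm s)
        exact hc.comp (fderivCLM ℂ (X × Y) V).continuous)
    refine ⟨s', C * C' * K, by positivity, fun F w => ?_⟩
    have h1 : ‖w.2‖ * ‖fiberFourierFun L F w‖ ≤
        K * ‖fiberFourierFun L (fderivCLM ℂ (X × Y) V F) w‖ := by
      have h4 : ‖(L.flip w.2).smulRight (fiberFourierFun L F w)‖ ≤
          ‖fiberFourierFun L (fderivCLM ℂ (X × Y) V F) w‖ := by
        refine ContinuousLinearMap.opNorm_le_bound _ (norm_nonneg _) fun v => ?_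
        have h5 := (fiberFourierFun L (fderivCLM ℂ (X × Y) V F) w).le_opNorm (0, v)
        rw [fiberFourierFun_fderiv, norm_smul] at h5
        simpa [norm_smul] using h5
      rw [ContinuousLinearMap.norm_smulRight_apply] at h4
      calc ‖w.2‖ * ‖fiberFourierFun L F w‖ ≤
          (K * ‖L.flip w.2‖) * ‖fiberFourierFun L F w‖ := by gcongr; exact hLK _
        _ = K * (‖L.flip w.2‖ * ‖fiberFourierFun L F w‖) := by ring
        _ ≤ _ := by gcongr
    have h2 := h (fderivCLM ℂ (X × Y) V F) w
    have h3 := h' F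
    calc ‖w.1‖ ^ j * ‖w.2‖ ^ (k + 1) * ‖fiberFourierFun L F w‖
        = ‖w.1‖ ^ j * ‖w.2‖ ^ k * (‖w.2‖ * ‖fiberFourierFun L F w‖) := by ring
      _ ≤ ‖w.1‖ ^ j * ‖w.2‖ ^ k * (K * ‖fiberFourierFun L (fderivCLM ℂ (X × Y) V F) w‖) := by gcongr
      _ = K * (‖w.1‖ ^ j * ‖w.2‖ ^ k * ‖fiberFourierFun L (fderivCLM ℂ (X × Y) V F) w‖) := by ring
      _ ≤ K * (C * (C' * s'.sup (schwartzSeminormFamily ℂ (X × Y) V) F)) := by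
        refine mul_le_mul_of_nonneg_left (h2.trans (mul_le_mul_of_nonneg_left h3 hC)) K.2
      _ = _ := by ring


theorem fderiv_fiberFourierFun (F : 𝓢(X × Y, V)) :
    fderiv ℝ (fiberFourierFun L F : X × Z → V) = fiberFourierFun L (fiberDeriv L F) :=
  funext fun w => (hasFDerivAt_fiberFourierFun L F w).fderiv

theorem contDiff_fiberFourierFun (n : ℕ) :
    ∀ (V : Type) [NormedAddCommGroup V] [NormedSpace ℝ V] [NormedSpace ℂ V] (F : 𝓢(X × Y, V)),
      ContDiff ℝ n (fiberFourierFun L F : X × Z → V) := by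
  induction n with
  | zero =>
    intro V _ _ _ F
    exact contDiff_zero.2 (continuous_iff_continuousAt.2 fun w =>
      (hasFDerivAt_fiberFourierFun L F w).continuousAt)
  | succ n ih =>
    intro V _ _ _ F
    push_cast
    refine contDiff_succ_iff_fderiv.2 ⟨fun w =>
      (hasFDerivAt_fiberFourierFun L F w).differentiableAt, by simp, ?_⟩
    rw [fderiv_fiberFourierFun]
    exact ih _ _

theorem seminorm_fiberFourierFun [FiniteDimensional ℝ Z] (hL : ∀ z, (∀ y, L y z = 0) → z = 0)
    (k n : ℕ) : ∀ (V : Type) [NormedAddCommGroup V] [NormedSpace ℝ V] [NormedSpace ℂ V],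
    ∃ (s : Finset (ℕ × ℕ)) (C : ℝ), 0 ≤ C ∧
    ∀ (F : 𝓢(X × Y, V)) (w : X × Z), ‖w‖ ^ k * ‖iteratedFDeriv ℝ n (fiberFourierFun L F) w‖ ≤
      C * s.sup (schwartzSeminormFamily ℂ (X × Y) V) F := by
  induction n with
  | zero =>
    intro V _ _ _
    obtain ⟨s, C, hC, h⟩ := decay_fiberFourierFun (X := X) L hL k 0 V
    obtain ⟨s', C', hC', h'⟩ := decay_fiberFourierFun (X := X) L hL 0 k V
    refine ⟨s ∪ s', C + C', by positivity, fun F w => ?_⟩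
    rw [norm_iteratedFDeriv_zero]
    have h1 := h F w
    have h2 := h' F w
    rw [pow_zero, mul_one] at h1
    rw [pow_zero, one_mul] at h2
    have m1 : s.sup (schwartzSeminormFamily ℂ (X × Y) V) F ≤
      (s ∪ s').sup (schwartzSeminormFamily ℂ (X × Y) V) F :=
      Seminorm.le_def.1 (Finset.sup_mono Finset.subset_union_left) F
    have m2 : s'.sup (schwartzSeminormFamily ℂ (X × Y) V) F ≤
      (s ∪ s').sup (schwartzSeminormFamily ℂ (X × Y) V) F :=
      Seminorm.le_def.1 (Finset.sup_mono Finset.subset_union_right) F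
    have h3 : ‖w‖ ^ k ≤ ‖w.1‖ ^ k + ‖w.2‖ ^ k := by
      rw [Prod.norm_def]
      rcases max_cases ‖w.1‖ ‖w.2‖ with ⟨h, -⟩ | ⟨h, -⟩ <;> rw [h] <;>
        [have := pow_nonneg (norm_nonneg w.2) k; have := pow_nonneg (norm_nonneg w.1) k] <;>
        linarith
    calc ‖w‖ ^ k * ‖fiberFourierFun L F w‖
        ≤ (‖w.1‖ ^ k + ‖w.2‖ ^ k) * ‖fiberFourierFun L F w‖ := by gcongr
      _ = ‖w.1‖ ^ k * ‖fiberFourierFun L F w‖ + ‖w.2‖ ^ k * ‖fiberFourierFun L F w‖ := by ring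
      _ ≤ C * s.sup (schwartzSeminormFamily ℂ (X × Y) V) F +
          C' * s'.sup (schwartzSeminormFamily ℂ (X × Y) V) F := add_le_add h1 h2
      _ ≤ C * (s ∪ s').sup (schwartzSeminormFamily ℂ (X × Y) V) F +
          C' * (s ∪ s').sup (schwartzSeminormFamily ℂ (X × Y) V) F := by gcongr
      _ = _ := by ring
  | succ n ih =>
    intro V _ _ _
    obtain ⟨s, C, hC, h⟩ := ih (X × Z →L[ℝ] V)
    obtain ⟨s', C', hC', h'⟩ := Seminorm.bound_of_continuous (schwartz_withSeminorms ℂ (X × Y) V)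
      ((s.sup (schwartzSeminormFamily ℂ (X × Y) (X × Z →L[ℝ] V))).comp
        (fiberDeriv L).toLinearMap) (by
        have hc := ((schwartz_withSeminorms ℂ (X × Y) (X × Z →L[ℝ] V)).finset_sups.continuous_seminorm s)
        exact hc.comp (fiberDeriv (V := V) L).continuous)
    refine ⟨s', C * C', by positivity, fun F w => ?_⟩
    rw [← norm_iteratedFDeriv_fderiv, fderiv_fiberFourierFun, mul_assoc]
    exact (h (fiberDeriv L F) w).trans (mul_le_mul_of_nonneg_left (h' F) hC)

/-- The fibrewise Fourier transform `F ↦ ((x, z) ↦ ∫ exp (-i L(y, z)) F(x, y) dy)` on Schwartz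
functions, for a pairing `L` which is nondegenerate in its second argument. -/
def fiberFourier [FiniteDimensional ℝ Z] (hL : ∀ z, (∀ y, L y z = 0) → z = 0) :
    𝓢(X × Y, V) →L[ℂ] 𝓢(X × Z, V) :=
  mkCLM (fun F => fiberFourierFun L F)
    (fun F G w => by
      simp only [fiberFourierFun, add_apply, smul_add]
      exact integral_add (integrable_fiber L F w) (integrable_fiber L G w))
    (fun a F w => by
      simp only [fiberFourierFun, smul_apply, smul_comm _ a]
      exact integral_smul _ _)
    (fun F => contDiff_infty.2 fun n => contDiff_fiberFourierFun L n V F)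
    (fun n => seminorm_fiberFourierFun L hL n.1 n.2 V)

theorem fiberFourier_apply [FiniteDimensional ℝ Z] (hL : ∀ z, (∀ y, L y z = 0) → z = 0)
    (F : 𝓢(X × Y, V)) (w : X × Z) :
    fiberFourier L hL F w = ∫ y, fiberChar (L y w.2) • F (w.1, y) := rfl

end FiberFourier
section Tools

variable {X Y : Type} [NormedAddCommGroup X] [NormedSpace ℝ X]
  [NormedAddCommGroup Y] [NormedSpace ℝ Y]

theorem hasTemperateGrowth_fiberChar : fiberChar.HasTemperateGrowth := by
  have hd : ∀ n : ℕ, iteratedDeriv n fiberChar = fun t => (-Complex.I) ^ n * fiberChar t := by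
    intro n
    induction n with
    | zero => simp
    | succ n ih =>
      rw [iteratedDeriv_succ, ih]
      ext t
      rw [((hasDerivAt_fiberChar t).const_mul _).deriv]
      ring
  refine ⟨?_, fun n => ⟨0, 1, fun t => ?_⟩⟩
  · exact Complex.contDiff_exp.comp (contDiff_const.mul Complex.ofRealCLM.contDiff).neg
  · rw [norm_iteratedFDeriv_eq_norm_iteratedDeriv, hd]
    simpa using (norm_fiberChar_smul t (1 : ℂ)).le

/-- Composition of a Schwartz function with an injective linear map. -/
def pullback [FiniteDimensional ℝ X] (g : X →L[ℝ] Y) (hg : Function.Injective g) :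
    𝓢(Y, ℂ) →L[ℂ] 𝓢(X, ℂ) :=
  compCLMOfAntilipschitz ℂ g.hasTemperateGrowth
    (LinearMap.exists_antilipschitzWith (g : X →ₗ[ℝ] Y)
      (LinearMap.ker_eq_bot.2 hg)).choose_spec.2

theorem pullback_apply [FiniteDimensional ℝ X] (g : X →L[ℝ] Y) (hg : Function.Injective g)
    (f : 𝓢(Y, ℂ)) (x : X) : pullback g hg f x = f (g x) := rfl

/-- Complex conjugation of Schwartz functions. -/
def conjS : 𝓢(X, ℂ) →SL[starRingEnd ℂ] 𝓢(X, ℂ) :=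
  mkCLM (fun f x => conj (f x)) (fun _ _ _ => by simp) (fun _ _ _ => by simp)
    (fun f => Complex.conjCLE.contDiff.comp (f.smooth ⊤)) fun n =>
      ⟨{n}, 1, zero_le_one, fun f x => by
        have h : ‖iteratedFDeriv ℝ n.2 (fun x => conj (f x)) x‖ = ‖iteratedFDeriv ℝ n.2 f x‖ :=
          Complex.conjLIE.norm_iteratedFDeriv_comp_left (f : X → ℂ) x n.2
        rw [h, Finset.sup_singleton, one_mul]
        exact le_seminorm ℂ n.1 n.2 f x⟩

theorem conjS_apply (f : 𝓢(X, ℂ)) (x : X) : conjS f x = conj (f x) := rfl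

theorem norm_iteratedFDeriv_comp_fst_le (f : 𝓢(X, ℂ)) (n : ℕ) (w : X × Y) :
    ‖iteratedFDeriv ℝ n (fun w : X × Y => f w.1) w‖ ≤ ‖iteratedFDeriv ℝ n f w.1‖ := by
  have h := (ContinuousLinearMap.fst ℝ X Y).iteratedFDeriv_comp_right (f.smooth n) w le_rfl
  change iteratedFDeriv ℝ n (fun w : X × Y => f w.1) w = _ at h
  rw [h]
  refine (ContinuousMultilinearMap.norm_compContinuousLinearMap_le _ _).trans ?_
  refine mul_le_of_le_one_right (norm_nonneg _) (Finset.prod_le_one (fun _ _ => norm_nonneg _)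
    fun _ _ => ContinuousLinearMap.norm_fst_le _ _ _)

theorem norm_iteratedFDeriv_comp_snd_le (f : 𝓢(Y, ℂ)) (n : ℕ) (w : X × Y) :
    ‖iteratedFDeriv ℝ n (fun w : X × Y => f w.2) w‖ ≤ ‖iteratedFDeriv ℝ n f w.2‖ := by
  have h := (ContinuousLinearMap.snd ℝ X Y).iteratedFDeriv_comp_right (f.smooth n) w le_rfl
  change iteratedFDeriv ℝ n (fun w : X × Y => f w.2) w = _ at h
  rw [h]
  refine (ContinuousMultilinearMap.norm_compContinuousLinearMap_le _ _).trans ?_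
  refine mul_le_of_le_one_right (norm_nonneg _) (Finset.prod_le_one (fun _ _ => norm_nonneg _)
    fun _ _ => ContinuousLinearMap.norm_snd_le _ _ _)

theorem seminorm_tensor_le (g : 𝓢(Y, ℂ)) (k n : ℕ) (f : 𝓢(X, ℂ)) (w : X × Y) :
    ‖w‖ ^ k * ‖iteratedFDeriv ℝ n (fun w : X × Y => f w.1 * g w.2) w‖ ≤
      (∑ i ∈ Finset.range (n + 1), (n.choose i : ℝ) *
        (SchwartzMap.seminorm ℂ 0 (n - i) g + SchwartzMap.seminorm ℂ k (n - i) g)) *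
      (Finset.Iic (k, n)).sup (schwartzSeminormFamily ℂ X ℂ) f := by
  set p := (Finset.Iic (k, n)).sup (schwartzSeminormFamily ℂ X ℂ) f with hp
  have hpi : ∀ j ≤ k, ∀ i ≤ n, SchwartzMap.seminorm ℂ j i f ≤ p := fun j hj i hi =>
    Seminorm.le_def.1 (Finset.le_sup (f := schwartzSeminormFamily ℂ X ℂ)
      (Finset.mem_Iic.2 (show (j, i) ≤ (k, n) from ⟨hj, hi⟩))) f
  have hw : ‖w‖ ^ k ≤ ‖w.1‖ ^ k + ‖w.2‖ ^ k := by
    rw [Prod.norm_def]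
    rcases max_cases ‖w.1‖ ‖w.2‖ with ⟨h, -⟩ | ⟨h, -⟩ <;> rw [h] <;>
      [have := pow_nonneg (norm_nonneg w.2) k; have := pow_nonneg (norm_nonneg w.1) k] <;>
      linarith
  have hmul := norm_iteratedFDeriv_mul_le (𝕜 := ℝ) (N := (n : ℕ∞))
    (f := fun w : X × Y => f w.1) (g := fun w : X × Y => g w.2)
    ((f.smooth n).comp contDiff_fst) ((g.smooth n).comp contDiff_snd) w (n := n) le_rfl
  refine (mul_le_mul hw hmul (norm_nonneg _) (by positivity)).trans ?_
  rw [Finset.mul_sum, Finset.sum_mul]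
  refine Finset.sum_le_sum fun i hi => ?_
  have hin : i ≤ n := Nat.lt_succ_iff.1 (Finset.mem_range.1 hi)
  have a1 := norm_iteratedFDeriv_comp_fst_le (Y := Y) f i w
  have a2 := norm_iteratedFDeriv_comp_snd_le (X := X) g (n - i) w
  have b1 := (le_seminorm ℂ k i f w.1).trans (hpi k le_rfl i hin)
  have b2 := (norm_iteratedFDeriv_le_seminorm ℂ f i w.1).trans (hpi 0 (Nat.zero_le _) i hin)
  have c1 := norm_iteratedFDeriv_le_seminorm ℂ g (n - i) w.2
  have c2 := le_seminorm ℂ k (n - i) g w.2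
  set A := ‖iteratedFDeriv ℝ i f w.1‖
  set B := ‖iteratedFDeriv ℝ (n - i) g w.2‖
  have hp0 : 0 ≤ p := (norm_nonneg _).trans b2
  calc (‖w.1‖ ^ k + ‖w.2‖ ^ k) * ((n.choose i : ℝ) *
        ‖iteratedFDeriv ℝ i (fun w : X × Y => f w.1) w‖ *
        ‖iteratedFDeriv ℝ (n - i) (fun w : X × Y => g w.2) w‖)
      ≤ (‖w.1‖ ^ k + ‖w.2‖ ^ k) * ((n.choose i : ℝ) * A * B) := by gcongr
    _ = (n.choose i : ℝ) * ((‖w.1‖ ^ k * A) * B + A * (‖w.2‖ ^ k * B)) := by ring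
    _ ≤ (n.choose i : ℝ) * (p * SchwartzMap.seminorm ℂ 0 (n - i) g +
          p * SchwartzMap.seminorm ℂ k (n - i) g) := by
        refine mul_le_mul_of_nonneg_left (add_le_add ?_ ?_) (Nat.cast_nonneg _)
        · exact mul_le_mul b1 c1 (norm_nonneg _) hp0
        · exact mul_le_mul b2 c2 (by positivity) hp0
    _ = _ := by ring

/-- The tensor product `f ⊗ g : (x, y) ↦ f(x) g(y)`, as a function of `f`. -/
def tensorRight (g : 𝓢(Y, ℂ)) : 𝓢(X, ℂ) →L[ℂ] 𝓢(X × Y, ℂ) :=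
  mkCLM (fun f w => f w.1 * g w.2) (fun _ _ _ => by simp [add_mul])
    (fun _ _ _ => by simp [mul_assoc])
    (fun f => ((f.smooth ⊤).comp contDiff_fst).mul ((g.smooth ⊤).comp contDiff_snd)) fun n =>
      ⟨_, _, Finset.sum_nonneg fun i _ => by positivity,
        fun f w => seminorm_tensor_le g n.1 n.2 f w⟩

theorem tensorRight_apply (g : 𝓢(Y, ℂ)) (f : 𝓢(X, ℂ)) (w : X × Y) :
    tensorRight g f w = f w.1 * g w.2 := rfl

/-- Integration over the second variable. -/
def fiberIntegral [FiniteDimensional ℝ X] [MeasureSpace Y] [BorelSpace Y] [FiniteDimensional ℝ Y]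
    [(volume : Measure Y).IsAddHaarMeasure] : 𝓢(X × Y, ℂ) →L[ℂ] 𝓢(X, ℂ) :=
  (pullback (ContinuousLinearMap.inl ℝ X (Fin 0 → ℝ)) (fun _ _ h => congrArg Prod.fst h)).comp
    (fiberFourier (0 : Y →L[ℝ] (Fin 0 → ℝ) →L[ℝ] ℝ) fun _ _ => Subsingleton.elim _ _)

theorem fiberIntegral_apply [FiniteDimensional ℝ X] [MeasureSpace Y] [BorelSpace Y]
    [FiniteDimensional ℝ Y] [(volume : Measure Y).IsAddHaarMeasure] (F : 𝓢(X × Y, ℂ)) (x : X) :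
    fiberIntegral F x = ∫ y, F (x, y) := by
  change ∫ y, fiberChar 0 • F (x, y) = _
  simp [fiberChar]

/-- For `B : 𝓢(Y) → 𝓢(X)`, the map `A : 𝓢'(X) → 𝓢'(Y)` given by
`⟨A u, χ⟩ = ⟨u, conj (B (conj χ))⟩`. If `B` is the `L²`-adjoint of an operator
`𝓢(X) → 𝓢(Y)`, this is the extension of that operator to tempered distributions. -/
def dualExtension (B : 𝓢(Y, ℂ) →L[ℂ] 𝓢(X, ℂ)) : 𝓢'(X, ℂ) →L[ℂ] 𝓢'(Y, ℂ) :=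
  PointwiseConvergenceCLM.precomp ℂ
    ((conjS : 𝓢(X, ℂ) →SL[starRingEnd ℂ] 𝓢(X, ℂ)).comp
      (B.comp (conjS : 𝓢(Y, ℂ) →SL[starRingEnd ℂ] 𝓢(Y, ℂ))))

theorem dualExtension_apply (B : 𝓢(Y, ℂ) →L[ℂ] 𝓢(X, ℂ)) (u : 𝓢'(X, ℂ)) (χ : 𝓢(Y, ℂ)) :
    dualExtension B u χ = u (conjS (B (conjS χ))) := rfl

/-- If `B` is the `L²`-adjoint of `A`, then `dualExtension B` extends `A`. -/
theorem dualExtension_coe [MeasureSpace X] [BorelSpace X] [FiniteDimensional ℝ X]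
    [(volume : Measure X).IsAddHaarMeasure] [MeasureSpace Y] [BorelSpace Y]
    [FiniteDimensional ℝ Y] [(volume : Measure Y).IsAddHaarMeasure]
    {A : 𝓢(X, ℂ) →L[ℂ] 𝓢(Y, ℂ)} {B : 𝓢(Y, ℂ) →L[ℂ] 𝓢(X, ℂ)}
    (h : ∀ ψ Ψ, ∫ y, A ψ y * conj (Ψ y) = ∫ x, ψ x * conj (B Ψ x)) (ψ : 𝓢(X, ℂ)) :
    dualExtension B (ψ : 𝓢'(X, ℂ)) = (A ψ : 𝓢'(Y, ℂ)) := by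
  ext χ
  rw [dualExtension_apply, SchwartzMap.coe_apply, SchwartzMap.coe_apply]
  have := h ψ (conjS χ)
  simp only [conjS_apply, Complex.conj_conj, smul_eq_mul] at this ⊢
  simp only [mul_comm (χ _), this, mul_comm (ψ _)]

end Tools

/-- Configuration space `ℝⁿ`. -/
abbrev Config (n : ℕ) := EuclideanSpace ℝ (Fin n)

/-- Phase space `ℝⁿ × ℝⁿ`, with points `z = (x, p)`. -/
abbrev Phase (n : ℕ) := Config n × Config n

instance (n : ℕ) : (volume : Measure (Phase n)).IsAddHaarMeasure :=
  inferInstanceAs ((volume : Measure (Config n)).prod (volume : Measure (Config n))).IsAddHaarMeasure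

section Operators

variable {n : ℕ}

/-- The standard symplectic form `σ(z, z') = p ⬝ x' - p' ⬝ x`, as a bilinear map. -/
def sympForm : Phase n →L[ℝ] Phase n →L[ℝ] ℝ :=
  (innerSL ℝ).bilinearComp (ContinuousLinearMap.snd ℝ (Config n) (Config n))
      (ContinuousLinearMap.fst ℝ (Config n) (Config n))
    - (innerSL ℝ).bilinearComp (ContinuousLinearMap.fst ℝ (Config n) (Config n))
      (ContinuousLinearMap.snd ℝ (Config n) (Config n))

theorem sympForm_apply (z z' : Phase n) :
    sympForm z z' = inner ℝ z.2 z'.1 - inner ℝ z'.2 z.1 := by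
  rw [real_inner_comm z'.2 z.1 |>.symm]
  rfl

/-- The pairing `(y, p) ↦ ħ⁻¹ y ⬝ p`. -/
def configPairing (ħ : ℝ) : Config n →L[ℝ] Config n →L[ℝ] ℝ := ħ⁻¹ • innerSL ℝ

theorem configPairing_apply (ħ : ℝ) (y p : Config n) : configPairing ħ y p = ħ⁻¹ * inner ℝ y p := rfl

theorem configPairing_nondeg {ħ : ℝ} (hħ : 0 < ħ) (p : Config n)
    (h : ∀ y, configPairing ħ y p = 0) : p = 0 := by
  have := h p
  simpa [configPairing_apply, hħ.ne'] using this

/-- The pairing `(v, u) ↦ ħ⁻¹ σ(v, u)`. -/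
def phasePairing (ħ : ℝ) : Phase n →L[ℝ] Phase n →L[ℝ] ℝ := ħ⁻¹ • sympForm

theorem phasePairing_apply (ħ : ℝ) (v u : Phase n) : phasePairing ħ v u = ħ⁻¹ * sympForm v u := rfl

theorem phasePairing_nondeg {ħ : ℝ} (hħ : 0 < ħ) (u : Phase n)
    (h : ∀ v, phasePairing ħ v u = 0) : u = 0 := by
  have h1 := h (0, u.1)
  have h2 := h (u.2, 0)
  simp only [phasePairing_apply, sympForm_apply, inner_zero_left, inner_zero_right, sub_zero,
    zero_sub, mul_eq_zero, inv_eq_zero, hħ.ne', false_or, neg_eq_zero, inner_self_eq_zero] at h1 h2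
  exact Prod.ext h1 h2

/-- The Heisenberg–Weyl operator
`(T̂(z₀) ψ)(x) = exp ((i/ħ) (p₀ ⬝ x - ½ p₀ ⬝ x₀)) ψ(x - x₀)`, `z₀ = (x₀, p₀)`. -/
def heisenbergWeyl (ħ : ℝ) (z₀ : Phase n) : 𝓢(Config n, ℂ) →L[ℂ] 𝓢(Config n, ℂ) :=
  (smulLeftCLM ℂ fun x : Config n =>
      Complex.exp (-(Complex.I * ((-(ħ⁻¹ * (inner ℝ z₀.2 x - (1 / 2) * inner ℝ z₀.2 z₀.1)) : ℝ) : ℂ)))).comp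
    (compSubConstCLM ℂ z₀.1)

theorem heisenbergWeyl_apply (ħ : ℝ) (z₀ : Phase n) (ψ : 𝓢(Config n, ℂ)) (x : Config n) :
    heisenbergWeyl ħ z₀ ψ x =
      Complex.exp (Complex.I / ħ * ((inner ℝ z₀.2 x : ℝ) - (1 / 2) * (inner ℝ z₀.2 z₀.1 : ℝ))) *
        ψ (x - z₀.1) := by
  have h : Function.HasTemperateGrowth fun x : Config n => Complex.exp (-(Complex.I *
      ((-(ħ⁻¹ * (inner ℝ z₀.2 x - (1 / 2) * inner ℝ z₀.2 z₀.1)) : ℝ) : ℂ))) := by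
    refine hasTemperateGrowth_fiberChar.comp
      (f := fun x : Config n => -(ħ⁻¹ * (inner ℝ z₀.2 x - (1 / 2) * inner ℝ z₀.2 z₀.1))) ?_
    have := Function.hasTemperateGrowth_inner_right z₀.2
    fun_prop
  rw [heisenbergWeyl, ContinuousLinearMap.comp_apply, smulLeftCLM_apply_apply h,
    compSubConstCLM_apply, smul_eq_mul]
  congr 2
  push_cast
  ring

/-- The phase-space operator `(T̃(z₀) Ψ)(z) = exp (-(i/ħ) σ(z, z₀)) Ψ(z - ½ z₀)`. -/
def phaseHeisenbergWeyl (ħ : ℝ) (z₀ : Phase n) : 𝓢(Phase n, ℂ) →L[ℂ] 𝓢(Phase n, ℂ) :=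
  (smulLeftCLM ℂ fun z : Phase n =>
      Complex.exp (-(Complex.I * ((ħ⁻¹ * sympForm z z₀ : ℝ) : ℂ)))).comp
    (compSubConstCLM ℂ ((1 / 2 : ℝ) • z₀))

theorem phaseHeisenbergWeyl_apply (ħ : ℝ) (z₀ : Phase n) (Ψ : 𝓢(Phase n, ℂ)) (z : Phase n) :
    phaseHeisenbergWeyl ħ z₀ Ψ z =
      Complex.exp (-(Complex.I / ħ) * (sympForm z z₀ : ℝ)) * Ψ (z - (1 / 2 : ℝ) • z₀) := by
  have h : Function.HasTemperateGrowth fun z : Phase n =>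
      Complex.exp (-(Complex.I * ((ħ⁻¹ * sympForm z z₀ : ℝ) : ℂ))) :=
    hasTemperateGrowth_fiberChar.comp (ħ⁻¹ • (sympForm (n := n)).flip z₀).hasTemperateGrowth
  rw [phaseHeisenbergWeyl, ContinuousLinearMap.comp_apply, smulLeftCLM_apply_apply h,
    compSubConstCLM_apply, smul_eq_mul]
  congr 2
  push_cast
  ring

/-- `(x, y) ↦ (x + ½ y, x - ½ y)`. -/
def midpointMap : Phase n →L[ℝ] Config n × Config n :=
  ContinuousLinearMap.prod
    (ContinuousLinearMap.fst ℝ _ _ + (1 / 2 : ℝ) • ContinuousLinearMap.snd ℝ _ _)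
    (ContinuousLinearMap.fst ℝ _ _ - (1 / 2 : ℝ) • ContinuousLinearMap.snd ℝ _ _)

theorem midpointMap_apply (w : Phase n) :
    midpointMap w = (w.1 + (1 / 2 : ℝ) • w.2, w.1 - (1 / 2 : ℝ) • w.2) := rfl

theorem midpointMap_injective : Function.Injective (midpointMap (n := n)) := by
  refine (injective_iff_map_eq_zero _).2 fun w h => ?_
  rw [midpointMap_apply] at h
  have h1 : w.1 + (1 / 2 : ℝ) • w.2 = 0 := congrArg Prod.fst h
  have h2 : w.1 - (1 / 2 : ℝ) • w.2 = 0 := congrArg Prod.snd h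
  have h3 : w.2 = (w.1 + (1 / 2 : ℝ) • w.2) - (w.1 - (1 / 2 : ℝ) • w.2) := by module
  have h4 : w.1 = (1 / 2 : ℝ) • ((w.1 + (1 / 2 : ℝ) • w.2) + (w.1 - (1 / 2 : ℝ) • w.2)) := by
    module
  refine Prod.ext ?_ ?_
  · rw [h4, h1, h2]; simp
  · rw [h3, h1, h2]; simp

variable {ħ : ℝ} (hħ : 0 < ħ)

/-- The cross-Wigner transform `ψ ↦ W(ψ, φ)`,
`W(ψ, φ)(x, p) = (2πħ)⁻ⁿ ∫ exp (-(i/ħ) p ⬝ y) ψ(x + ½ y) conj φ(x - ½ y) dy`. -/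
def crossWigner (φ : 𝓢(Config n, ℂ)) : 𝓢(Config n, ℂ) →L[ℂ] 𝓢(Phase n, ℂ) :=
  (((1 / (2 * π * ħ)) ^ n : ℝ) : ℂ) •
    (fiberFourier (configPairing ħ) (configPairing_nondeg hħ)).comp
      ((pullback midpointMap midpointMap_injective).comp (tensorRight (conjS φ)))

theorem crossWigner_apply (φ ψ : 𝓢(Config n, ℂ)) (z : Phase n) :
    crossWigner hħ φ ψ z = (((1 / (2 * π * ħ)) ^ n : ℝ) : ℂ) *
      ∫ y : Config n, Complex.exp (-(Complex.I / ħ) * (inner ℝ z.2 y : ℝ)) *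
        (ψ (z.1 + (1 / 2 : ℝ) • y) * conj (φ (z.1 - (1 / 2 : ℝ) • y))) := by
  change (((1 / (2 * π * ħ)) ^ n : ℝ) : ℂ) * ∫ y : Config n, _ = _
  congr 2
  ext y
  change fiberChar (configPairing ħ y z.2) *
    (ψ (z.1 + (1 / 2 : ℝ) • y) * conj (φ (z.1 - (1 / 2 : ℝ) • y))) = _
  rw [configPairing_apply, fiberChar, real_inner_comm]
  congr 2
  push_cast
  ring

/-- The transform `W_φ ψ = (2πħ)^{n/2} W(ψ, φ)`. -/
def wavePacket (φ : 𝓢(Config n, ℂ)) : 𝓢(Config n, ℂ) →L[ℂ] 𝓢(Phase n, ℂ) :=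
  (((2 * π * ħ) ^ ((n : ℝ) / 2) : ℝ) : ℂ) • crossWigner hħ φ

theorem wavePacket_apply (φ ψ : 𝓢(Config n, ℂ)) (z : Phase n) :
    wavePacket hħ φ ψ z = (((1 / (2 * π * ħ)) ^ ((n : ℝ) / 2) : ℝ) : ℂ) *
      ∫ y : Config n, Complex.exp (-(Complex.I / ħ) * (inner ℝ z.2 y : ℝ)) *
        (ψ (z.1 + (1 / 2 : ℝ) • y) * conj (φ (z.1 - (1 / 2 : ℝ) • y))) := by
  change (((2 * π * ħ) ^ ((n : ℝ) / 2) : ℝ) : ℂ) * crossWigner hħ φ ψ z = _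
  rw [crossWigner_apply, ← mul_assoc, ← Complex.ofReal_mul]
  congr 3
  have h : 0 < 2 * π * ħ := by positivity
  rw [← Real.rpow_natCast, one_div, Real.inv_rpow h.le, Real.inv_rpow h.le, ← Real.rpow_neg h.le,
    ← Real.rpow_neg h.le, ← Real.rpow_add h]
  congr 1
  ring

/-- `(x, y) ↦ (y, 2 (y - x))`. -/
def adjointMap : Phase n →L[ℝ] Phase n :=
  ContinuousLinearMap.prod (ContinuousLinearMap.snd ℝ _ _)
    ((2 : ℝ) • (ContinuousLinearMap.snd ℝ _ _ - ContinuousLinearMap.fst ℝ _ _))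

theorem adjointMap_injective : Function.Injective (adjointMap (n := n)) := by
  intro w w' h
  have h1 : w.2 = w'.2 := congrArg Prod.fst h
  have h2 : (2 : ℝ) • (w.2 - w.1) = (2 : ℝ) • (w'.2 - w'.1) := congrArg Prod.snd h
  rw [h1] at h2
  exact Prod.ext (sub_right_injective (smul_right_injective _ (two_ne_zero (α := ℝ)) h2)) h1

theorem hasTemperateGrowth_reflect (φ : 𝓢(Config n, ℂ)) :
    Function.HasTemperateGrowth fun w : Phase n => φ ((2 : ℝ) • w.2 - w.1) :=
  φ.hasTemperateGrowth.comp ((2 : ℝ) • ContinuousLinearMap.snd ℝ (Config n) (Config n) -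
    ContinuousLinearMap.fst ℝ (Config n) (Config n)).hasTemperateGrowth

/-- The adjoint `W_φ^*` of `W_φ`,
`(W_φ^* Ψ)(x) = (2/(πħ))^{n/2} ∫∫ exp ((2i/ħ) p ⬝ (x - y)) φ(2y - x) Ψ(y, p) dp dy`. -/
def wavePacketAdjoint (φ : 𝓢(Config n, ℂ)) : 𝓢(Phase n, ℂ) →L[ℂ] 𝓢(Config n, ℂ) :=
  (((2 / (π * ħ)) ^ ((n : ℝ) / 2) : ℝ) : ℂ) •
    fiberIntegral.comp ((smulLeftCLM ℂ fun w : Phase n => φ ((2 : ℝ) • w.2 - w.1)).comp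
      ((pullback adjointMap adjointMap_injective).comp
        (fiberFourier (configPairing ħ) (configPairing_nondeg hħ))))

theorem wavePacketAdjoint_apply (φ : 𝓢(Config n, ℂ)) (Ψ : 𝓢(Phase n, ℂ)) (x : Config n) :
    wavePacketAdjoint hħ φ Ψ x = (((2 / (π * ħ)) ^ ((n : ℝ) / 2) : ℝ) : ℂ) *
      ∫ y : Config n, ∫ p : Config n,
        Complex.exp (2 * Complex.I / ħ * (inner ℝ p (x - y) : ℝ)) *
          (φ ((2 : ℝ) • y - x) * Ψ (y, p)) := by
  rw [wavePacketAdjoint, smul_apply, smul_apply, smul_eq_mul, ContinuousLinearMap.comp_apply,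
    fiberIntegral_apply]
  congr 2
  ext y
  rw [ContinuousLinearMap.comp_apply, smulLeftCLM_apply_apply (hasTemperateGrowth_reflect φ)]
  change φ ((2 : ℝ) • y - x) * (∫ p, fiberChar (configPairing ħ p ((2 : ℝ) • (y - x))) * Ψ (y, p)) = _
  rw [← integral_const_mul]
  congr 1
  ext p
  rw [← mul_assoc, mul_comm (φ _), mul_assoc]
  congr 1
  rw [configPairing_apply, fiberChar, inner_smul_right, ← neg_sub x y, inner_neg_right]
  congr 1
  push_cast
  ring

/-- `(q, p) ↦ (q, -p)`. -/
def flipMap : Phase n →L[ℝ] Phase n :=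
  ContinuousLinearMap.prod (ContinuousLinearMap.fst ℝ _ _) (-ContinuousLinearMap.snd ℝ _ _)

theorem flipMap_injective : Function.Injective (flipMap (n := n)) := by
  intro w w' h
  have h1 : w.1 = w'.1 := show (flipMap w).1 = (flipMap w').1 from congrArg Prod.fst h
  have h2 : -w.2 = -w'.2 := congrArg Prod.snd h
  exact Prod.ext h1 (neg_injective h2)

/-- `F ↦ ((q, p) ↦ (2πħ)⁻ⁿ ∫ exp ((i/ħ) p ⬝ s) F(q + ½ s, q - ½ s) ds)`. -/
def kernelTest : 𝓢(Config n × Config n, ℂ) →L[ℂ] 𝓢(Phase n, ℂ) :=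
  (((1 / (2 * π * ħ)) ^ n : ℝ) : ℂ) • (pullback flipMap flipMap_injective).comp
    ((fiberFourier (configPairing ħ) (configPairing_nondeg hħ)).comp
      (pullback midpointMap midpointMap_injective))

theorem kernelTest_apply (F : 𝓢(Config n × Config n, ℂ)) (z : Phase n) :
    kernelTest hħ F z = (((1 / (2 * π * ħ)) ^ n : ℝ) : ℂ) *
      ∫ s : Config n, Complex.exp (Complex.I / ħ * (inner ℝ z.2 s : ℝ)) *
        F (z.1 + (1 / 2 : ℝ) • s, z.1 - (1 / 2 : ℝ) • s) := by
  change (((1 / (2 * π * ħ)) ^ n : ℝ) : ℂ) * ∫ y : Config n, _ = _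
  congr 2
  ext y
  change fiberChar (configPairing ħ y (-z.2)) *
    F (z.1 + (1 / 2 : ℝ) • y, z.1 - (1 / 2 : ℝ) • y) = _
  rw [configPairing_apply, fiberChar, inner_neg_right, real_inner_comm]
  congr 2
  push_cast
  ring

/-- The kernel of the Weyl operator with symbol `H`, that is, the tempered distribution
`K(x, y) = (2πħ)⁻ⁿ ∫ exp ((i/ħ) p ⬝ (x - y)) H(½ (x + y), p) dp`. -/
def weylKernel (H : 𝓢'(Phase n, ℂ)) : 𝓢'(Config n × Config n, ℂ) :=
  PointwiseConvergenceCLM.precomp ℂ (kernelTest hħ) H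

/-- The Weyl operator `Ĥ : 𝓢(ℝⁿ) → 𝓢'(ℝⁿ)` with symbol `H`: `Ĥψ(x) = ⟨K(x, ·), ψ⟩`, that is,
`⟨Ĥψ, χ⟩ = ⟨K, χ ⊗ ψ⟩`, where `K` is the kernel associated with `H`. -/
def weylOperator (H : 𝓢'(Phase n, ℂ)) (ψ : 𝓢(Config n, ℂ)) : 𝓢'(Config n, ℂ) :=
  PointwiseConvergenceCLM.precomp ℂ (tensorRight ψ) (weylKernel hħ H)

theorem weylOperator_apply (H : 𝓢'(Phase n, ℂ)) (ψ χ : 𝓢(Config n, ℂ)) :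
    weylOperator hħ H ψ χ = H (kernelTest hħ (tensorRight ψ χ)) := rfl

/-- `(u, v) ↦ (½ (u + v), u - v)`. -/
def symbolMap : Config n × Config n →L[ℝ] Phase n :=
  ContinuousLinearMap.prod
    ((1 / 2 : ℝ) • (ContinuousLinearMap.fst ℝ _ _ + ContinuousLinearMap.snd ℝ _ _))
    (ContinuousLinearMap.fst ℝ _ _ - ContinuousLinearMap.snd ℝ _ _)

theorem symbolMap_midpointMap (w : Phase n) : symbolMap (midpointMap w) = w := by
  change ((1 / 2 : ℝ) • ((w.1 + (1 / 2 : ℝ) • w.2) + (w.1 - (1 / 2 : ℝ) • w.2)),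
    (w.1 + (1 / 2 : ℝ) • w.2) - (w.1 - (1 / 2 : ℝ) • w.2)) = w
  refine Prod.ext ?_ ?_
  · change (1 / 2 : ℝ) • ((w.1 + (1 / 2 : ℝ) • w.2) + (w.1 - (1 / 2 : ℝ) • w.2)) = w.1
    module
  · change (w.1 + (1 / 2 : ℝ) • w.2) - (w.1 - (1 / 2 : ℝ) • w.2) = w.2
    module

theorem midpointMap_symbolMap (w : Config n × Config n) : midpointMap (symbolMap w) = w := by
  change ((1 / 2 : ℝ) • (w.1 + w.2) + (1 / 2 : ℝ) • (w.1 - w.2),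
    (1 / 2 : ℝ) • (w.1 + w.2) - (1 / 2 : ℝ) • (w.1 - w.2)) = w
  refine Prod.ext ?_ ?_
  · change (1 / 2 : ℝ) • (w.1 + w.2) + (1 / 2 : ℝ) • (w.1 - w.2) = w.1
    module
  · change (1 / 2 : ℝ) • (w.1 + w.2) - (1 / 2 : ℝ) • (w.1 - w.2) = w.2
    module

/-- The contravariant (Weyl) symbol of the operator with kernel `K`,
`a(x, p) = ∫ exp (-(i/ħ) p ⬝ y) K(x + ½ y, x - ½ y) dy` in the sense of distributions. -/
def weylSymbol (K : 𝓢'(Config n × Config n, ℂ)) : 𝓢'(Phase n, ℂ) :=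
  PointwiseConvergenceCLM.precomp ℂ
    ((pullback symbolMap (Function.LeftInverse.injective midpointMap_symbolMap)).comp
      (fiberFourier (configPairing ħ) (configPairing_nondeg hħ))) K

/-- `(z, v) ↦ (z, z - ½ v)`. -/
def starMap : Phase n × Phase n →L[ℝ] Phase n × Phase n :=
  ContinuousLinearMap.prod (ContinuousLinearMap.fst ℝ _ _)
    (ContinuousLinearMap.fst ℝ _ _ - (1 / 2 : ℝ) • ContinuousLinearMap.snd ℝ _ _)

theorem starMap_injective : Function.Injective (starMap (n := n)) := by
  intro w w' h
  have h1 : w.1 = w'.1 := show (starMap w).1 = (starMap w').1 from congrArg Prod.fst h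
  have h2 : w.1 - (1 / 2 : ℝ) • w.2 = w'.1 - (1 / 2 : ℝ) • w'.2 := congrArg Prod.snd h
  rw [h1] at h2
  exact Prod.ext h1 (smul_right_injective _ (by norm_num : (1 / 2 : ℝ) ≠ 0)
    (sub_right_injective h2))

/-- `(w, z) ↦ (z, w - z)`. -/
def shiftMap : Phase n × Phase n →L[ℝ] Phase n × Phase n :=
  ContinuousLinearMap.prod (ContinuousLinearMap.snd ℝ _ _)
    (ContinuousLinearMap.fst ℝ _ _ - ContinuousLinearMap.snd ℝ _ _)

theorem shiftMap_injective : Function.Injective (shiftMap (n := n)) := by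
  intro w w' h
  have h1 : w.2 = w'.2 := congrArg Prod.fst h
  have h2 : w.1 - w.2 = w'.1 - w'.2 := congrArg Prod.snd h
  rw [h1] at h2
  exact Prod.ext (sub_left_injective h2) h1

/-- The transpose of `a ↦ a ⋆ b`,
`Φ ↦ (w ↦ (2πħ)⁻²ⁿ ∫∫ exp ((i/ħ) σ(w - z, v)) b(z - ½ v) Φ(z) dv dz)`. -/
def starTest (b : 𝓢(Phase n, ℂ)) : 𝓢(Phase n, ℂ) →L[ℂ] 𝓢(Phase n, ℂ) :=
  (((1 / (2 * π * ħ)) ^ (2 * n) : ℝ) : ℂ) • fiberIntegral.comp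
    ((pullback shiftMap shiftMap_injective).comp
      ((fiberFourier (phasePairing ħ) (phasePairing_nondeg hħ)).comp
        ((pullback starMap starMap_injective).comp (tensorRight b))))

theorem sympForm_swap (z z' : Phase n) : sympForm z z' = -sympForm z' z := by
  rw [sympForm_apply, sympForm_apply]
  ring

theorem starTest_apply (b Φ : 𝓢(Phase n, ℂ)) (w : Phase n) :
    starTest hħ b Φ w = (((1 / (2 * π * ħ)) ^ (2 * n) : ℝ) : ℂ) *
      ∫ z : Phase n, ∫ v : Phase n, Complex.exp (Complex.I / ħ * (sympForm (w - z) v : ℝ)) *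
        (Φ z * b (z - (1 / 2 : ℝ) • v)) := by
  rw [starTest, smul_apply, smul_apply, smul_eq_mul, ContinuousLinearMap.comp_apply,
    fiberIntegral_apply]
  congr 2
  ext z
  change ∫ v, fiberChar (phasePairing ħ v (w - z)) * (Φ z * b (z - (1 / 2 : ℝ) • v)) = _
  congr 1
  ext v
  rw [phasePairing_apply, fiberChar, sympForm_swap]
  congr 2
  push_cast
  ring

/-- The Moyal product `a ⋆ b` of a tempered distribution `a` and a Schwartz function `b`. It is
defined by duality from the formula `(a ⋆ b)(z) = (4πħ)⁻²ⁿ ∫∫ exp ((i/(2ħ)) σ(u, v))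
a(z + ½ u) b(z - ½ v) du dv` for a function `a`, after the substitution `w = z + ½ u`. -/
def moyalProduct (a : 𝓢'(Phase n, ℂ)) (b : 𝓢(Phase n, ℂ)) : 𝓢'(Phase n, ℂ) :=
  PointwiseConvergenceCLM.precomp ℂ (starTest hħ b) a

theorem moyalProduct_apply (a : 𝓢'(Phase n, ℂ)) (b Φ : 𝓢(Phase n, ℂ)) :
    moyalProduct hħ a b Φ = a (starTest hħ b Φ) := rfl

end Operators

section Consistency

variable {n : ℕ} {ħ : ℝ} (hħ : 0 < ħ)

theorem integral_heisenbergWeyl_mul_conj (z₀ : Phase n) (ψ χ : 𝓢(Config n, ℂ)) :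
    ∫ x, heisenbergWeyl ħ z₀ ψ x * conj (χ x) =
      ∫ x, ψ x * conj (heisenbergWeyl ħ (-z₀) χ x) := by
  rw [← integral_sub_right_eq_self (fun x => ψ x * conj (heisenbergWeyl ħ (-z₀) χ x)) z₀.1]
  congr 1
  ext x
  rw [heisenbergWeyl_apply, heisenbergWeyl_apply, map_mul, ← Complex.exp_conj]
  have e : x - z₀.1 - (-z₀).1 = x := by simp
  rw [e, mul_comm (Complex.exp _) (ψ _), mul_assoc]
  congr 3
  simp only [map_mul, map_sub, map_div₀, Complex.conj_I, Complex.conj_ofReal, Prod.snd_neg,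
    Prod.fst_neg, inner_neg_left, inner_neg_right, inner_sub_right, map_one, map_ofNat]
  push_cast
  ring

theorem integral_phaseHeisenbergWeyl_mul_conj (z₀ : Phase n) (Ψ Φ : 𝓢(Phase n, ℂ)) :
    ∫ z, phaseHeisenbergWeyl ħ z₀ Ψ z * conj (Φ z) =
      ∫ z, Ψ z * conj (phaseHeisenbergWeyl ħ (-z₀) Φ z) := by
  rw [← integral_sub_right_eq_self (fun z => Ψ z * conj (phaseHeisenbergWeyl ħ (-z₀) Φ z))
    ((1 / 2 : ℝ) • z₀)]
  congr 1
  ext z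
  rw [phaseHeisenbergWeyl_apply, phaseHeisenbergWeyl_apply, map_mul, ← Complex.exp_conj]
  have e : z - (1 / 2 : ℝ) • z₀ - (1 / 2 : ℝ) • (-z₀) = z := by module
  have e' : sympForm (z - (1 / 2 : ℝ) • z₀) (-z₀) = -sympForm z z₀ := by
    simp only [sympForm_apply, Prod.snd_sub, Prod.fst_sub, Prod.snd_neg, Prod.fst_neg,
      Prod.smul_fst, Prod.smul_snd, inner_neg_left, inner_neg_right, inner_sub_left,
      inner_sub_right, inner_smul_left, inner_smul_right, conj_trivial]
    ring
  rw [e, e', mul_comm (Complex.exp _) (Ψ _), mul_assoc]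
  congr 3
  simp only [map_mul, map_neg, map_div₀, Complex.conj_I, Complex.conj_ofReal]
  push_cast
  ring

theorem integrable_mul_schwartz {X : Type} [NormedAddCommGroup X] [NormedSpace ℝ X]
    [MeasureSpace X] [BorelSpace X] [FiniteDimensional ℝ X]
    [(volume : Measure X).IsAddHaarMeasure] (f g : 𝓢(X, ℂ)) : Integrable fun x => f x * g x :=
  (SchwartzMap.pairing (ContinuousLinearMap.mul ℂ ℂ) f g).integrable

theorem integral_comp_two_smul_sub (x : Config n) (g : Config n → ℂ) :
    ∫ y, g y = (2 : ℂ) ^ n * ∫ X, g ((2 : ℝ) • (X - x)) := by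
  rw [integral_sub_right_eq_self (fun X => g ((2 : ℝ) • X)), Measure.integral_comp_smul,
    finrank_euclideanSpace_fin, abs_of_pos (by positivity), Complex.real_smul, ← mul_assoc]
  push_cast
  rw [mul_inv_cancel₀ (pow_ne_zero _ two_ne_zero), one_mul]

/-- `W_φ^*` is the `L²`-adjoint of `W_φ`. -/
theorem integral_wavePacket_mul_conj (φ ψ : 𝓢(Config n, ℂ)) (Ψ : 𝓢(Phase n, ℂ)) :
    ∫ z, wavePacket hħ φ ψ z * conj (Ψ z) = ∫ x, ψ x * conj (wavePacketAdjoint hħ φ Ψ x) := by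
  set P := fiberFourier (configPairing (n := n) ħ) (configPairing_nondeg hħ) Ψ with hP
  set G : 𝓢(Phase n, ℂ) := pullback midpointMap midpointMap_injective (tensorRight (conjS φ) ψ)
    with hG
  set T : 𝓢(Phase n, ℂ) := smulLeftCLM ℂ (fun w : Phase n => φ ((2 : ℝ) • w.2 - w.1))
    (pullback adjointMap adjointMap_injective P) with hT
  set c₁ : ℂ := (((2 * π * ħ) ^ ((n : ℝ) / 2) : ℝ) : ℂ) * (((1 / (2 * π * ħ)) ^ n : ℝ) : ℂ)
    with hc₁
  set c₂ : ℝ := (2 / (π * ħ)) ^ ((n : ℝ) / 2) with hc₂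
  have hc : c₁ * 2 ^ n = c₂ := by
    have h : 0 < π * ħ := by positivity
    rw [hc₁, hc₂, ← Complex.ofReal_mul, ← Complex.ofReal_ofNat, ← Complex.ofReal_pow,
      ← Complex.ofReal_mul, Complex.ofReal_inj, mul_assoc, ← mul_pow]
    have e : 1 / (2 * π * ħ) * 2 = (π * ħ)⁻¹ := by field_simp
    rw [e, mul_assoc 2 π ħ, Real.mul_rpow (by norm_num) h.le, Real.div_rpow (by norm_num) h.le,
      mul_assoc, div_eq_mul_inv]
    congr 1
    rw [← Real.rpow_natCast, Real.inv_rpow h.le, ← Real.rpow_neg h.le, ← Real.rpow_neg h.le,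
      ← Real.rpow_add h]
    congr 1
    ring
  have hW : ∀ x p, wavePacket hħ φ ψ (x, p) =
      c₁ * ∫ y, fiberChar (configPairing ħ y p) * G (x, y) := fun x p => by
    rw [hc₁, mul_assoc]; rfl
  have hTa : ∀ X x, T (X, x) = φ ((2 : ℝ) • x - X) * P (x, (2 : ℝ) • (x - X)) := fun X x => by
    rw [hT, smulLeftCLM_apply_apply (hasTemperateGrowth_reflect φ)]; rfl
  have hA : ∀ X, wavePacketAdjoint hħ φ Ψ X = (c₂ : ℂ) * ∫ x, T (X, x) := fun X => by
    rw [← fiberIntegral_apply]; rfl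
  have hPc : ∀ x y, ∫ p, fiberChar (configPairing ħ y p) * conj (Ψ (x, p)) = conj (P (x, -y)) := by
    intro x y
    rw [hP, fiberFourier_apply, ← integral_conj]
    congr 1
    ext p
    rw [smul_eq_mul, map_mul]
    congr 1
    rw [fiberChar, fiberChar, ← Complex.exp_conj, configPairing_apply, configPairing_apply,
      inner_neg_right, real_inner_comm]
    congr 1
    simp only [map_neg, map_mul, Complex.conj_I, Complex.conj_ofReal]
    push_cast
    ring
  have hslice : ∀ (F : 𝓢(Phase n, ℂ)) (x : Config n), Integrable fun y => F (x, y) := fun F x => by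
    have := integrable_fiber (0 : Config n →L[ℝ] Config n →L[ℝ] ℝ) F (x, 0)
    simpa [fiberChar] using this
  have step1 : ∀ x, ∫ p, wavePacket hħ φ ψ (x, p) * conj (Ψ (x, p)) =
      (c₂ : ℂ) * ∫ X, ψ X * conj (T (X, x)) := by
    intro x
    have hint : Integrable (fun q : Config n × Config n =>
        fiberChar (configPairing ħ q.2 q.1) * (conj (Ψ (x, q.1)) * G (x, q.2)))
        ((volume : Measure (Config n)).prod volume) := by
      have h1 := (hslice (conjS Ψ) x).mul_prod (hslice G x)
      refine h1.bdd_mul (c := 1) ?_ (.of_forall fun q => ?_)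
      · exact (continuous_fiberChar.comp (by
          simp only [configPairing_apply]; fun_prop)).aestronglyMeasurable
      · simpa using (norm_fiberChar_smul (configPairing ħ q.2 q.1) (1 : ℂ)).le
    calc ∫ p, wavePacket hħ φ ψ (x, p) * conj (Ψ (x, p))
        = ∫ p, c₁ * ∫ y, fiberChar (configPairing ħ y p) * (conj (Ψ (x, p)) * G (x, y)) := by
          congr 1; ext p
          rw [hW, mul_assoc, ← integral_mul_const]
          congr 2; ext y; ring
      _ = c₁ * ∫ y, ∫ p, fiberChar (configPairing ħ y p) * (conj (Ψ (x, p)) * G (x, y)) := by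
          rw [integral_const_mul, integral_integral_swap hint]
      _ = c₁ * ∫ y, G (x, y) * conj (P (x, -y)) := by
          congr 2; ext y
          rw [← hPc, ← integral_const_mul]
          congr 1; ext p; ring
      _ = c₁ * (2 ^ n * ∫ X, ψ X * conj (T (X, x))) := by
          rw [integral_comp_two_smul_sub x]
          congr 3; ext X
          rw [hTa, map_mul, ← mul_assoc]
          have e1 : x + (1 / 2 : ℝ) • (2 : ℝ) • (X - x) = X := by module
          have e2 : x - (1 / 2 : ℝ) • (2 : ℝ) • (X - x) = (2 : ℝ) • x - X := by module
          have e3 : -((2 : ℝ) • (X - x)) = (2 : ℝ) • (x - X) := by module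
          have e4 : G (x, (2 : ℝ) • (X - x)) = ψ (x + (1 / 2 : ℝ) • (2 : ℝ) • (X - x)) *
            conj (φ (x - (1 / 2 : ℝ) • (2 : ℝ) • (X - x))) := rfl
          rw [e4, e1, e2, e3]
      _ = _ := by rw [← mul_assoc, hc]
  have hint2 : Integrable (fun q : Config n × Config n => ψ q.2 * conj (T (q.2, q.1)))
      ((volume : Measure (Config n)).prod volume) := by
    have h1 : Integrable (fun q : Config n × Config n => ψ q.1 * conj (T q))
        ((volume : Measure (Config n)).prod volume) := by
      have h0 : Integrable (conjS T) ((volume : Measure (Config n)).prod volume) :=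
        (conjS T).integrable (μ := (volume : Measure (Phase n)))
      refine h0.bdd_mul (c := SchwartzMap.seminorm ℂ 0 0 ψ)
        (ψ.continuous.comp continuous_fst).aestronglyMeasurable
        (.of_forall fun q => norm_le_seminorm ℂ ψ q.1)
    exact h1.swap
  have hL : ∫ z, wavePacket hħ φ ψ z * conj (Ψ z) =
      ∫ x, ∫ p, wavePacket hħ φ ψ (x, p) * conj (Ψ (x, p)) :=
    integral_prod _ (integrable_mul_schwartz (wavePacket hħ φ ψ) (conjS Ψ))
  rw [hL]
  simp only [step1]
  rw [integral_const_mul, integral_integral_swap hint2, ← integral_const_mul]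
  congr 1
  ext X
  rw [hA, map_mul, Complex.conj_ofReal, integral_const_mul, ← integral_conj]
  ring

/-- The Weyl symbol of the Weyl operator with symbol `H` is `H`. -/
theorem weylSymbol_weylKernel (H : 𝓢'(Phase n, ℂ)) : weylSymbol hħ (weylKernel hħ H) = H := by
  ext Φ
  change H (kernelTest hħ (pullback symbolMap
    (Function.LeftInverse.injective midpointMap_symbolMap)
    (fiberFourier (configPairing ħ) (configPairing_nondeg hħ) Φ))) = H Φ
  congr 1
  ext z
  have hslice : ∀ (F : 𝓢(Phase n, ℂ)) (x : Config n), Integrable fun y => F (x, y) := fun F x => by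
    have := integrable_fiber (0 : Config n →L[ℝ] Config n →L[ℝ] ℝ) F (x, 0)
    simpa [fiberChar] using this
  set P := fiberFourier (configPairing (n := n) ħ) (configPairing_nondeg hħ) Φ with hP
  have h2 : 0 < 2 * π * ħ := by positivity
  have hF : ∀ t : Config n, P (z.1, (2 * π * ħ) • t) =
      FourierTransform.fourier (fun p => Φ (z.1, p)) t := fun t => by
    rw [Real.fourier_eq', hP, fiberFourier_apply]
    congr 1
    ext p
    rw [fiberChar, configPairing_apply, inner_smul_right]
    congr 2
    push_cast
    have : (ħ : ℂ) ≠ 0 := by exact_mod_cast hħ.ne'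
    field_simp
  have hinv : FourierTransformInv.fourierInv
      (FourierTransform.fourier (fun p => Φ (z.1, p))) = fun p => Φ (z.1, p) := by
    refine Continuous.fourierInv_fourier_eq (Φ.continuous.comp (by fun_prop)) (hslice Φ z.1) ?_
    have h3 := (hslice P z.1).comp_smul h2.ne'
    exact h3.congr (.of_forall hF)
  rw [kernelTest_apply]
  have e : ∀ s : Config n, pullback symbolMap
      (Function.LeftInverse.injective midpointMap_symbolMap) P
      (z.1 + (1 / 2 : ℝ) • s, z.1 - (1 / 2 : ℝ) • s) = P (z.1, s) := fun s => by
    rw [pullback_apply]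
    exact congrArg P (symbolMap_midpointMap (z.1, s))
  simp only [e]
  have hval := congrFun hinv z.2
  rw [Real.fourierInv_eq'] at hval
  simp only [← hF] at hval
  have hsub := Measure.integral_comp_smul (volume : Measure (Config n))
    (fun s => Complex.exp (Complex.I / ħ * (inner ℝ z.2 s : ℝ)) * P (z.1, s)) (2 * π * ħ)
  have hval' : ∫ t : Config n, Complex.exp (Complex.I / ħ *
      (inner ℝ z.2 ((2 * π * ħ) • t) : ℝ)) * P (z.1, (2 * π * ħ) • t) = Φ z := by
    rw [← hval]
    congr 1
    ext t
    rw [smul_eq_mul, inner_smul_right, real_inner_comm]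
    congr 2
    push_cast
    have : (ħ : ℂ) ≠ 0 := by exact_mod_cast hħ.ne'
    field_simp
  rw [hval', finrank_euclideanSpace_fin, abs_of_pos (by positivity), Complex.real_smul] at hsub
  rw [hsub, one_div, inv_pow]

/-- The Moyal product of two Schwartz functions is given by the usual integral formula. -/
theorem moyalProduct_coe (a b Φ : 𝓢(Phase n, ℂ)) :
    moyalProduct hħ (a : 𝓢'(Phase n, ℂ)) b Φ =
      ∫ z : Phase n, Φ z * ((((1 / (4 * π * ħ)) ^ (2 * n) : ℝ) : ℂ) *
        ∫ u : Phase n, ∫ v : Phase n, Complex.exp (Complex.I / (2 * ħ) * (sympForm u v : ℝ)) *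
          (a (z + (1 / 2 : ℝ) • u) * b (z - (1 / 2 : ℝ) • v))) := by
  set Q : 𝓢(Phase n × Phase n, ℂ) := pullback shiftMap shiftMap_injective
    (fiberFourier (phasePairing ħ) (phasePairing_nondeg hħ)
      (pullback starMap starMap_injective (tensorRight b Φ))) with hQ
  have hQa : ∀ w z, Q (w, z) = ∫ v : Phase n,
      Complex.exp (Complex.I / ħ * (sympForm (w - z) v : ℝ)) *
        (Φ z * b (z - (1 / 2 : ℝ) • v)) := fun w z => by
    change ∫ v, fiberChar (phasePairing ħ v (w - z)) * (Φ z * b (z - (1 / 2 : ℝ) • v)) = _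
    congr 1
    ext v
    rw [phasePairing_apply, fiberChar, sympForm_swap]
    congr 2
    push_cast
    ring
  have hint : Integrable (fun q : Phase n × Phase n => a q.1 * Q q)
      ((volume : Measure (Phase n)).prod volume) := by
    have hm : ((volume : Measure (Phase n)).prod (volume : Measure (Phase n))).IsAddHaarMeasure :=
      Measure.prod.instIsAddHaarMeasure _ _
    have h0 : Integrable Q ((volume : Measure (Phase n)).prod volume) := Q.integrable
    exact h0.bdd_mul (c := SchwartzMap.seminorm ℂ 0 0 a)
      (a.continuous.comp continuous_fst).aestronglyMeasurable
      (.of_forall fun q => norm_le_seminorm ℂ a q.1)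
  set c : ℝ := (1 / (2 * π * ħ)) ^ (2 * n) with hc
  have h1 : moyalProduct hħ (a : 𝓢'(Phase n, ℂ)) b Φ =
      ∫ w, (c : ℂ) * ∫ z, a w * Q (w, z) := by
    rw [moyalProduct_apply, SchwartzMap.coe_apply]
    congr 1
    ext w
    rw [starTest_apply, smul_eq_mul, mul_assoc, mul_comm _ (a w), ← integral_const_mul]
    simp only [hQa]
    rfl
  rw [h1, integral_const_mul, integral_integral_swap hint, ← integral_const_mul]
  congr 1
  ext z
  have hsub := Measure.integral_comp_smul (volume : Measure (Phase n))
    (fun u => a (z + u) * Q (z + u, z)) (1 / 2 : ℝ)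
  rw [integral_add_left_eq_self (fun w => a w * Q (w, z)) z] at hsub
  have hd : Module.finrank ℝ (Phase n) = 2 * n := by
    rw [Module.finrank_prod, finrank_euclideanSpace_fin]; ring
  have h2n : (0 : ℝ) < 2 ^ (2 * n) := by positivity
  rw [hd, abs_of_pos (by positivity), Complex.real_smul, ← inv_pow, one_div, inv_inv] at hsub
  have e : (((1 / (4 * π * ħ)) ^ (2 * n) : ℝ) : ℂ) * (((2 : ℝ) ^ (2 * n) : ℝ) : ℂ) = c := by
    rw [hc, ← Complex.ofReal_mul, ← mul_pow]
    congr 2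
    field_simp
    norm_num
  rw [← e, mul_assoc, ← hsub, mul_left_comm (Φ z)]
  congr 1
  rw [← integral_const_mul]
  congr 1
  ext u
  have e2 : z + (2 : ℝ)⁻¹ • u - z = (2 : ℝ)⁻¹ • u := by module
  rw [hQa, e2, ← integral_const_mul, ← integral_const_mul]
  congr 1
  ext v
  have e3 : Complex.exp (Complex.I / ħ * (sympForm ((2 : ℝ)⁻¹ • u) v : ℝ)) =
      Complex.exp (Complex.I / (2 * ħ) * (sympForm u v : ℝ)) := by
    rw [map_smul, smul_apply, smul_eq_mul]
    congr 1
    push_cast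
    have : (ħ : ℂ) ≠ 0 := by exact_mod_cast hħ.ne'
    field_simp
  rw [e3, one_div]
  ring

end Consistency

section Extensions

variable {n : ℕ} {ħ : ℝ} (hħ : 0 < ħ)

/-- The extension of `T̂(z₀)`, whose adjoint is `T̂(-z₀)`, to tempered distributions. -/
def heisenbergWeylExt (ħ : ℝ) (z₀ : Phase n) : 𝓢'(Config n, ℂ) →L[ℂ] 𝓢'(Config n, ℂ) :=
  dualExtension (heisenbergWeyl ħ (-z₀))

/-- The extension of `T̃(z₀)`, whose adjoint is `T̃(-z₀)`, to tempered distributions. -/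
def phaseHeisenbergWeylExt (ħ : ℝ) (z₀ : Phase n) : 𝓢'(Phase n, ℂ) →L[ℂ] 𝓢'(Phase n, ℂ) :=
  dualExtension (phaseHeisenbergWeyl ħ (-z₀))

/-- The extension of `W_φ` to tempered distributions. -/
def wavePacketExt (φ : 𝓢(Config n, ℂ)) : 𝓢'(Config n, ℂ) →L[ℂ] 𝓢'(Phase n, ℂ) :=
  dualExtension (wavePacketAdjoint hħ φ)

/-- The extension of `W_φ^*` to tempered distributions. -/
def wavePacketAdjointExt (φ : 𝓢(Config n, ℂ)) : 𝓢'(Phase n, ℂ) →L[ℂ] 𝓢'(Config n, ℂ) :=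
  dualExtension (wavePacket hħ φ)

theorem heisenbergWeylExt_coe (z₀ : Phase n) (ψ : 𝓢(Config n, ℂ)) :
    heisenbergWeylExt ħ z₀ (ψ : 𝓢'(Config n, ℂ)) = (heisenbergWeyl ħ z₀ ψ : 𝓢'(Config n, ℂ)) :=
  dualExtension_coe (integral_heisenbergWeyl_mul_conj z₀) ψ

theorem phaseHeisenbergWeylExt_coe (z₀ : Phase n) (Ψ : 𝓢(Phase n, ℂ)) :
    phaseHeisenbergWeylExt ħ z₀ (Ψ : 𝓢'(Phase n, ℂ)) =
      (phaseHeisenbergWeyl ħ z₀ Ψ : 𝓢'(Phase n, ℂ)) :=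
  dualExtension_coe (integral_phaseHeisenbergWeyl_mul_conj z₀) Ψ

theorem wavePacketExt_coe (φ ψ : 𝓢(Config n, ℂ)) :
    wavePacketExt hħ φ (ψ : 𝓢'(Config n, ℂ)) = (wavePacket hħ φ ψ : 𝓢'(Phase n, ℂ)) :=
  dualExtension_coe (integral_wavePacket_mul_conj hħ φ) ψ

theorem wavePacketAdjointExt_coe (φ : 𝓢(Config n, ℂ)) (Ψ : 𝓢(Phase n, ℂ)) :
    wavePacketAdjointExt hħ φ (Ψ : 𝓢'(Phase n, ℂ)) =
      (wavePacketAdjoint hħ φ Ψ : 𝓢'(Config n, ℂ)) := by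
  refine dualExtension_coe (fun Ψ ψ => ?_) Ψ
  have h := congrArg conj (integral_wavePacket_mul_conj hħ φ ψ Ψ)
  rw [← integral_conj, ← integral_conj] at h
  simp only [map_mul, Complex.conj_conj] at h
  simp only [mul_comm (wavePacketAdjoint hħ φ Ψ _), mul_comm (Ψ _)]
  exact h.symm

end Extensions

end PhaseSpace

end

/-!
Covariance: for Schwartz functions, a translation of the integration variable gives
`W_φ T̂(z₀) = T̃(z₀) W_φ` (`wavePacket_heisenbergWeyl`). The adjoints of `T̂(z₀)` and `T̃(z₀)` are
`T̂(-z₀)` and `T̃(-z₀)`, so `W_φ^* T̃(z₀) = T̂(z₀) W_φ^*`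
(`wavePacketAdjoint_phaseHeisenbergWeyl`), and this is the transposed form of the covariance of
`W_φ` on tempered distributions.

Intertwining: both sides are linear in the symbol `H`, and by definition each is `H` evaluated at a
Schwartz function. It therefore suffices to show that these two Schwartz functions coincide. For
`H ⋆ W_φ ψ = W_φ (Ĥ ψ)` this is `starTest_wavePacket`: in the phase-space integral over
`v = (v₁, v₂)` the function `W_φ ψ` is a Fourier transform in its momentum variable, so Fourier
inversion removes `v₂` (`integral_exp_sympForm_mul_fiberFourier`); what is left is, after Fubini,
the integral defining `W_φ^*` inside the one defining the Weyl kernel.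

The intertwining for `W_φ^*` follows from that for `W_φ` by complex conjugation, which reverses
Moyal products (`conjS_starTest_conjS`) and exchanges the two variables of the Weyl kernel
(`conjS_kernelTest_tensorRight`).
-/

namespace PhaseSpace

/-! ### Covariance under the Heisenberg–Weyl operators -/

section Covariance

variable {n : ℕ} {ħ : ℝ} (hħ : 0 < ħ)

theorem wavePacket_heisenbergWeyl (φ ψ : 𝓢(Config n, ℂ)) (z₀ : Phase n) :
    wavePacket hħ φ (heisenbergWeyl ħ z₀ ψ) = phaseHeisenbergWeyl ħ z₀ (wavePacket hħ φ ψ) := by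
  ext z
  rw [phaseHeisenbergWeyl_apply, wavePacket_apply, wavePacket_apply, mul_left_comm]
  congr 1
  -- The translation `y ↦ y + x₀` turns the shift of `ψ` by `x₀` into a shift of `x` by `x₀ / 2`.
  rw [← integral_add_right_eq_self _ z₀.1, ← integral_const_mul]
  congr 1
  ext y
  have e1 : z.1 + (1 / 2 : ℝ) • (y + z₀.1) - z₀.1 =
      (z - (1 / 2 : ℝ) • z₀).1 + (1 / 2 : ℝ) • y := by
    simp only [Prod.fst_sub, Prod.smul_fst]; module
  have e2 : z.1 - (1 / 2 : ℝ) • (y + z₀.1) = (z - (1 / 2 : ℝ) • z₀).1 - (1 / 2 : ℝ) • y := by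
    simp only [Prod.fst_sub, Prod.smul_fst]; module
  rw [heisenbergWeyl_apply, e1, e2, mul_assoc (Complex.exp _) (ψ _), ← mul_assoc, ← Complex.exp_add,
    ← mul_assoc (Complex.exp _) (Complex.exp _), ← Complex.exp_add]
  congr 2
  simp only [sympForm_apply, Prod.snd_sub, Prod.smul_snd, inner_add_right, inner_sub_left,
    inner_smul_left, inner_smul_right, conj_trivial]
  push_cast
  ring

/-- A Schwartz function is determined by its `L²` inner products with Schwartz functions. -/
theorem eq_of_forall_integral_mul_conj_eq {X : Type} [NormedAddCommGroup X] [NormedSpace ℝ X]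
    [MeasureSpace X] [BorelSpace X] [FiniteDimensional ℝ X]
    [(volume : Measure X).IsAddHaarMeasure] {f g : 𝓢(X, ℂ)}
    (h : ∀ χ : 𝓢(X, ℂ), ∫ x, χ x * conj (f x) = ∫ x, χ x * conj (g x)) : f = g := by
  have h0 : ∫ x, (f - g) x * conj ((f - g) x) = 0 := by
    have e : ∀ x, (f - g) x * conj ((f - g) x) =
        (f - g) x * conj (f x) - (f - g) x * conj (g x) := fun x => by
      rw [← mul_sub, ← map_sub]; rfl
    simp only [e]
    have hf : Integrable fun x => (f - g) x * conj (f x) :=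
      integrable_mul_schwartz (f - g) (conjS f)
    have hg : Integrable fun x => (f - g) x * conj (g x) :=
      integrable_mul_schwartz (f - g) (conjS g)
    rw [integral_sub hf hg, h, sub_self]
  simp only [Complex.mul_conj] at h0
  rw [integral_complex_ofReal, Complex.ofReal_eq_zero] at h0
  have hint : Integrable fun x => Complex.normSq ((f - g) x) := by
    have := (integrable_mul_schwartz (f - g) (conjS (f - g))).re
    refine this.congr (.of_forall fun x => ?_)
    simp only [conjS_apply, Complex.mul_conj]
    exact Complex.ofReal_re _
  have hz : (fun x => Complex.normSq ((f - g) x)) = 0 :=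
    (Continuous.ae_eq_iff_eq volume (Complex.continuous_normSq.comp (f - g).continuous)
      continuous_const).1 ((integral_eq_zero_iff_of_nonneg (fun x => Complex.normSq_nonneg _)
        hint).1 h0)
  refine sub_eq_zero.1 (SchwartzMap.ext fun x => ?_)
  exact Complex.normSq_eq_zero.1 (congrFun hz x)

theorem wavePacketAdjoint_phaseHeisenbergWeyl (φ : 𝓢(Config n, ℂ)) (z₀ : Phase n)
    (Ψ : 𝓢(Phase n, ℂ)) :
    wavePacketAdjoint hħ φ (phaseHeisenbergWeyl ħ z₀ Ψ) =
      heisenbergWeyl ħ z₀ (wavePacketAdjoint hħ φ Ψ) := by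
  -- Take `L²`-adjoints in `wavePacket_heisenbergWeyl` at `-z₀`.
  refine eq_of_forall_integral_mul_conj_eq fun χ => ?_
  have h1 := integral_phaseHeisenbergWeyl_mul_conj (ħ := ħ) (-z₀) (wavePacket hħ φ χ) Ψ
  have h2 := integral_heisenbergWeyl_mul_conj (ħ := ħ) (-z₀) χ (wavePacketAdjoint hħ φ Ψ)
  rw [neg_neg] at h1 h2
  rw [← integral_wavePacket_mul_conj, ← h1, ← wavePacket_heisenbergWeyl,
    integral_wavePacket_mul_conj, h2]

theorem conjS_conjS {X : Type} [NormedAddCommGroup X] [NormedSpace ℝ X] (f : 𝓢(X, ℂ)) :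
    conjS (conjS f) = f := by
  ext x
  simp [conjS_apply]

theorem wavePacketExt_heisenbergWeylExt (φ : 𝓢(Config n, ℂ)) (z₀ : Phase n)
    (u : 𝓢'(Config n, ℂ)) :
    wavePacketExt hħ φ (heisenbergWeylExt ħ z₀ u) =
      phaseHeisenbergWeylExt ħ z₀ (wavePacketExt hħ φ u) := by
  ext χ
  simp only [wavePacketExt, heisenbergWeylExt, phaseHeisenbergWeylExt, dualExtension_apply,
    conjS_conjS, wavePacketAdjoint_phaseHeisenbergWeyl]

end Covariance

/-! ### Fourier inversion in the momentum variable -/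

section Inversion

variable {n : ℕ} {ħ : ℝ} (hħ : 0 < ħ)

theorem norm_exp_I_div_mul (ħ r : ℝ) : ‖Complex.exp (Complex.I / ħ * (r : ℝ))‖ = 1 := by
  have : Complex.I / (ħ : ℂ) * (r : ℂ) = ((r / ħ : ℝ) : ℂ) * Complex.I := by push_cast; ring
  rw [this, Complex.norm_exp_ofReal_mul_I]

/-- Fibrewise Fourier inversion. This is the statement that the Weyl symbol of the Weyl operator
with symbol `δ` is `δ`. -/
theorem integral_exp_mul_fiberFourier (G : 𝓢(Phase n, ℂ)) (a t : Config n) :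
    ∫ s, Complex.exp (Complex.I / ħ * (inner ℝ t s : ℝ)) *
        fiberFourier (configPairing ħ) (configPairing_nondeg hħ) G (a, s) =
      (((2 * π * ħ) ^ n : ℝ) : ℂ) * G (a, t) := by
  have h := congrArg (fun u : 𝓢'(Phase n, ℂ) => u G)
    (weylSymbol_weylKernel hħ (TemperedDistribution.delta (a, t)))
  change kernelTest hħ (pullback symbolMap
    (Function.LeftInverse.injective midpointMap_symbolMap)
    (fiberFourier (configPairing ħ) (configPairing_nondeg hħ) G)) (a, t) = G (a, t) at h
  rw [kernelTest_apply] at h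
  have e : ∀ s : Config n, pullback symbolMap
      (Function.LeftInverse.injective midpointMap_symbolMap)
      (fiberFourier (configPairing ħ) (configPairing_nondeg hħ) G)
      (a + (1 / 2 : ℝ) • s, a - (1 / 2 : ℝ) • s) =
      fiberFourier (configPairing ħ) (configPairing_nondeg hħ) G (a, s) := fun s => by
    rw [pullback_apply]
    exact congrArg _ (symbolMap_midpointMap (a, s))
  simp only [e] at h
  have h2 : 0 < 2 * π * ħ := by positivity
  rw [← h, ← mul_assoc, ← Complex.ofReal_mul, ← mul_pow, mul_one_div_cancel h2.ne', one_pow,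
    Complex.ofReal_one, one_mul]

instance (n : ℕ) : (volume : Measure (Phase n)).IsNegInvariant :=
  Measure.IsAddHaarMeasure.isNegInvariant_of_regular _

/-- The inner integral of the Moyal product with a fibrewise Fourier transform: the momentum
component of `v` is integrated out by Fourier inversion. -/
theorem integral_exp_sympForm_mul_fiberFourier (G : 𝓢(Phase n, ℂ)) (w z : Phase n) :
    ∫ v : Phase n, Complex.exp (Complex.I / ħ * (sympForm (w - z) v : ℝ)) *
        fiberFourier (configPairing ħ) (configPairing_nondeg hħ) G (z - (1 / 2 : ℝ) • v) =
      (((4 * π * ħ) ^ n : ℝ) : ℂ) * ∫ s : Config n,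
        Complex.exp (Complex.I / ħ *
            (inner ℝ (w.2 - z.2) s - 2 * inner ℝ z.2 (w.1 - z.1) : ℝ)) *
          G (z.1 - (1 / 2 : ℝ) • s, (2 : ℝ) • (w.1 - z.1)) := by
  set P := fiberFourier (configPairing (n := n) ħ) (configPairing_nondeg hħ) G with hP
  have hint : Integrable (fun v : Config n × Config n =>
      Complex.exp (Complex.I / ħ * (sympForm (w - z) v : ℝ)) * P (z - (1 / 2 : ℝ) • v))
      ((volume : Measure (Config n)).prod volume) := by
    have h1 : Integrable (fun v : Phase n => P (z - (1 / 2 : ℝ) • v)) :=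
      (P.integrable.comp_sub_left z).comp_smul (by norm_num : (1 / 2 : ℝ) ≠ 0)
    refine h1.bdd_mul (c := 1) (Continuous.aestronglyMeasurable (by fun_prop))
      (.of_forall fun v => (norm_exp_I_div_mul _ _).le)
  change ∫ v, _ ∂((volume : Measure (Config n)).prod volume) = _
  rw [integral_prod _ hint, ← integral_const_mul]
  congr 1
  ext s
  -- Fourier inversion after the substitution `z.2 - t / 2`, whose Jacobian `2 ^ n` turns
  -- `(2πħ) ^ n` into `(4πħ) ^ n`.
  have hinv := integral_exp_mul_fiberFourier hħ G (z.1 - (1 / 2 : ℝ) • s) ((2 : ℝ) • (w.1 - z.1))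
  rw [← hP, ← integral_sub_left_eq_self _ volume z.2] at hinv
  have hsub := Measure.integral_comp_smul (volume : Measure (Config n))
    (fun t => Complex.exp (Complex.I / ħ * (inner ℝ ((2 : ℝ) • (w.1 - z.1)) (z.2 - t) : ℝ)) *
        P (z.1 - (1 / 2 : ℝ) • s, z.2 - t)) (1 / 2 : ℝ)
  rw [hinv, finrank_euclideanSpace_fin, abs_of_pos (by positivity), Complex.real_smul,
    ← mul_assoc, ← Complex.ofReal_mul, ← inv_pow, ← mul_pow] at hsub
  have e4 : ((1 / 2 : ℝ)⁻¹ * (2 * π * ħ)) = 4 * π * ħ := by ring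
  rw [e4] at hsub
  rw [mul_left_comm, ← hsub, ← integral_const_mul]
  congr 1
  ext t
  rw [← mul_assoc, ← Complex.exp_add]
  have e5 : z - (1 / 2 : ℝ) • (s, t) = (z.1 - (1 / 2 : ℝ) • s, z.2 - (1 / 2 : ℝ) • t) := rfl
  rw [e5]
  congr 2
  rw [← mul_add, ← Complex.ofReal_add]
  congr 2
  simp only [sympForm_apply, Prod.snd_sub, Prod.fst_sub, inner_sub_left, inner_sub_right,
    inner_smul_right, real_inner_comm z.2, real_inner_comm t]
  ring

end Inversion

/-! ### The transposes of the Weyl and Moyal operators -/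

section Intertwining

variable {n : ℕ} {ħ : ℝ} (hħ : 0 < ħ)

/-- The normalising constants on the two sides of `starTest_wavePacket` agree. -/
theorem rpow_half_mul_inv_pow (hħ : 0 < ħ) : (1 / (2 * π * ħ)) ^ (2 * n) *
    ((2 * π * ħ) ^ ((n : ℝ) / 2) * (1 / (2 * π * ħ)) ^ n * (4 * π * ħ) ^ n) =
      (1 / (2 * π * ħ)) ^ n * (2 / (π * ħ)) ^ ((n : ℝ) / 2) := by
  have h : 0 < 2 * π * ħ := by positivity
  have e1 : 4 * π * ħ = 2 * (2 * π * ħ) := by ring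
  have e2 : 2 / (π * ħ) = 2 ^ 2 / (2 * π * ħ) := by field_simp
  have e3 : ((2 : ℝ) ^ 2) ^ ((n : ℝ) / 2) = 2 ^ n := by
    rw [← Real.rpow_natCast, ← Real.rpow_mul (by norm_num), ← Real.rpow_natCast]
    congr 1
    push_cast
    ring
  have e4 : (2 * π * ħ) ^ n = (2 * π * ħ) ^ ((n : ℝ) / 2) * (2 * π * ħ) ^ ((n : ℝ) / 2) := by
    rw [← Real.rpow_add h, ← Real.rpow_natCast]
    congr 1
    ring
  have h5 : 0 < (2 * π * ħ) ^ ((n : ℝ) / 2) := by positivity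
  rw [e1, e2, Real.div_rpow (by norm_num) h.le, e3, mul_pow, pow_mul', one_div, inv_pow, e4]
  field_simp

/-- The identity behind `H ⋆ W_φ ψ = W_φ (Ĥ ψ)`, transposed onto the test function `Φ`. Once
`integral_exp_sympForm_mul_fiberFourier` has removed the momentum part of `v`, both sides are
iterated integrals of one function of `(s, z)`, in opposite orders. -/
theorem starTest_wavePacket (φ ψ : 𝓢(Config n, ℂ)) (Φ : 𝓢(Phase n, ℂ)) :
    starTest hħ (wavePacket hħ φ ψ) Φ =
      kernelTest hħ (tensorRight ψ (conjS (wavePacketAdjoint hħ φ (conjS Φ)))) := by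
  ext w
  set g : Config n → Phase n → ℂ := fun s z => Φ z * (Complex.exp (Complex.I / ħ *
      (inner ℝ (w.2 - z.2) s - 2 * inner ℝ z.2 (w.1 - z.1) : ℝ)) *
    (ψ (w.1 - (1 / 2 : ℝ) • s) * conj (φ ((2 : ℝ) • z.1 - w.1 - (1 / 2 : ℝ) • s)))) with hg
  set c₁ : ℝ := (2 * π * ħ) ^ ((n : ℝ) / 2) * (1 / (2 * π * ħ)) ^ n with hc₁
  set c₂ : ℝ := (2 / (π * ħ)) ^ ((n : ℝ) / 2) with hc₂
  have hL : ∀ z : Phase n, ∫ v : Phase n, Complex.exp (Complex.I / ħ * (sympForm (w - z) v : ℝ)) *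
      (Φ z * wavePacket hħ φ ψ (z - (1 / 2 : ℝ) • v)) =
      ((c₁ * (4 * π * ħ) ^ n : ℝ) : ℂ) * ∫ s, g s z := fun z => by
    have e : ∀ v : Phase n, Complex.exp (Complex.I / ħ * (sympForm (w - z) v : ℝ)) *
        (Φ z * wavePacket hħ φ ψ (z - (1 / 2 : ℝ) • v)) = (Φ z * c₁) *
        (Complex.exp (Complex.I / ħ * (sympForm (w - z) v : ℝ)) *
          fiberFourier (configPairing ħ) (configPairing_nondeg hħ)
            (pullback midpointMap midpointMap_injective (tensorRight (conjS φ) ψ))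
            (z - (1 / 2 : ℝ) • v)) := fun v => by
      have e0 : wavePacket hħ φ ψ (z - (1 / 2 : ℝ) • v) = (c₁ : ℂ) *
          fiberFourier (configPairing ħ) (configPairing_nondeg hħ)
            (pullback midpointMap midpointMap_injective (tensorRight (conjS φ) ψ))
            (z - (1 / 2 : ℝ) • v) := by
        rw [hc₁, Complex.ofReal_mul, mul_assoc]; rfl
      rw [e0]
      ring
    simp only [e]
    rw [integral_const_mul, integral_exp_sympForm_mul_fiberFourier hħ,
      Complex.ofReal_mul c₁, hg]
    simp only [integral_const_mul]
    have hs : ∀ s : Config n, pullback midpointMap midpointMap_injective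
        (tensorRight (conjS φ) ψ) (z.1 - (1 / 2 : ℝ) • s, (2 : ℝ) • (w.1 - z.1)) =
        ψ (w.1 - (1 / 2 : ℝ) • s) * conj (φ ((2 : ℝ) • z.1 - w.1 - (1 / 2 : ℝ) • s)) := fun s => by
      rw [pullback_apply, midpointMap_apply, tensorRight_apply, conjS_apply]
      have e1 : z.1 - (1 / 2 : ℝ) • s + (1 / 2 : ℝ) • (2 : ℝ) • (w.1 - z.1) =
        w.1 - (1 / 2 : ℝ) • s := by module
      have e2 : z.1 - (1 / 2 : ℝ) • s - (1 / 2 : ℝ) • (2 : ℝ) • (w.1 - z.1) =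
        (2 : ℝ) • z.1 - w.1 - (1 / 2 : ℝ) • s := by module
      simp only [e1, e2]
    simp only [hs]
    ring
  have hφ : ∀ x, ‖conj (φ x)‖ ≤ SchwartzMap.seminorm ℂ 0 0 φ := fun x => by
    rw [RCLike.norm_conj]; exact norm_le_seminorm ℂ φ x
  have hgs : ∀ s, Integrable (g s) ((volume : Measure (Config n)).prod volume) := fun s => by
    have h0 : Integrable Φ ((volume : Measure (Config n)).prod volume) :=
      Φ.integrable (μ := (volume : Measure (Phase n)))
    refine h0.mul_bdd (c := ‖ψ (w.1 - (1 / 2 : ℝ) • s)‖ * SchwartzMap.seminorm ℂ 0 0 φ)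
      (Continuous.aestronglyMeasurable ?_) (.of_forall fun z => ?_)
    · have := φ.continuous
      fun_prop
    · rw [norm_mul, norm_exp_I_div_mul, one_mul, norm_mul]
      gcongr
      exact hφ _
  have hgi : Integrable (fun q : Phase n × Config n => g q.2 q.1)
      ((volume : Measure (Phase n)).prod volume) := by
    have h1 : Integrable (fun s : Config n => ψ (w.1 - (1 / 2 : ℝ) • s)) :=
      (ψ.integrable.comp_sub_left w.1).comp_smul (by norm_num : (1 / 2 : ℝ) ≠ 0)
    have h0 : Integrable Φ (volume : Measure (Phase n)) := Φ.integrable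
    have h2 := (h0.mul_prod h1).mul_bdd
      (g := fun q => Complex.exp (Complex.I / ħ *
        (inner ℝ (w.2 - q.1.2) q.2 - 2 * inner ℝ q.1.2 (w.1 - q.1.1) : ℝ)) *
        conj (φ ((2 : ℝ) • q.1.1 - w.1 - (1 / 2 : ℝ) • q.2)))
      (c := SchwartzMap.seminorm ℂ 0 0 φ)
      (Continuous.aestronglyMeasurable (by have := φ.continuous; fun_prop))
      (.of_forall fun q => by
        rw [norm_mul, norm_exp_I_div_mul, one_mul]
        exact hφ _)
    refine h2.congr (.of_forall fun q => ?_)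
    simp only [hg]
    ring
  have hR : ∀ s : Config n, Complex.exp (Complex.I / ħ * (inner ℝ w.2 s : ℝ)) *
      tensorRight ψ (conjS (wavePacketAdjoint hħ φ (conjS Φ)))
        (w.1 + (1 / 2 : ℝ) • s, w.1 - (1 / 2 : ℝ) • s) = (c₂ : ℂ) * ∫ z, g s z := fun s => by
    have e1 : ∫ z, g s z = ∫ x, ∫ p, g s (x, p) := integral_prod _ (hgs s)
    rw [tensorRight_apply, conjS_apply, wavePacketAdjoint_apply, map_mul, Complex.conj_ofReal,
      ← integral_conj, e1, mul_assoc (c₂ : ℂ), mul_left_comm, ← integral_mul_const,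
      ← integral_const_mul]
    congr 2
    ext x
    rw [← integral_conj, ← integral_mul_const, ← integral_const_mul]
    congr 1
    ext p
    have e2 : (2 : ℝ) • x - (w.1 + (1 / 2 : ℝ) • s) = (2 : ℝ) • x - w.1 - (1 / 2 : ℝ) • s := by
      module
    have e3 : Complex.exp (Complex.I / ħ *
        (inner ℝ (w.2 - p) s - 2 * inner ℝ p (w.1 - x) : ℝ)) =
        Complex.exp (Complex.I / ħ * (inner ℝ w.2 s : ℝ)) *
        conj (Complex.exp (2 * Complex.I / ħ *
          (inner ℝ p (w.1 + (1 / 2 : ℝ) • s - x) : ℝ))) := by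
      rw [← Complex.exp_conj, ← Complex.exp_add]
      congr 1
      simp only [map_mul, map_div₀, Complex.conj_I, Complex.conj_ofReal, map_ofNat,
        inner_sub_left, inner_sub_right, inner_add_right, inner_smul_right]
      push_cast
      ring
    simp only [hg]
    rw [e2, e3, conjS_apply, map_mul, map_mul, Complex.conj_conj]
    ring
  rw [starTest_apply, kernelTest_apply]
  simp only [hL, hR]
  rw [integral_const_mul, integral_const_mul, integral_integral_swap hgi, ← mul_assoc,
    ← mul_assoc, ← Complex.ofReal_mul, ← Complex.ofReal_mul, rpow_half_mul_inv_pow hħ]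

/-- The transposed form of `conj (a ⋆ b) = conj b ⋆ conj a`: in `∫ (a ⋆ b) Φ` the roles of `b` and
`Φ` are exchanged by conjugation. -/
theorem conjS_starTest_conjS (b Φ : 𝓢(Phase n, ℂ)) :
    conjS (starTest hħ (conjS Φ) (conjS b)) = starTest hħ b Φ := by
  set d : ℂ := ((|(((1 / 2 : ℝ) ^ (Module.finrank ℝ (Phase n)))⁻¹)| : ℝ) : ℂ) with hd
  -- `d` is the Jacobian of `v = 2 (z - z')`; its value plays no role.
  -- The symmetric form of the integral, in the variables `z` and `z' = z - v / 2`.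
  have key : ∀ (b Φ : 𝓢(Phase n, ℂ)) (w z : Phase n),
      ∫ v : Phase n, Complex.exp (Complex.I / ħ * (sympForm (w - z) v : ℝ)) *
        (Φ z * b (z - (1 / 2 : ℝ) • v)) =
      d * ∫ z' : Phase n, Complex.exp (Complex.I / ħ *
        (2 * (sympForm w z - sympForm w z' + sympForm z z') : ℝ)) * (Φ z * b z') := by
    intro b Φ w z
    rw [← integral_sub_left_eq_self (fun z' => Complex.exp (Complex.I / ħ *
        (2 * (sympForm w z - sympForm w z' + sympForm z z') : ℝ)) * (Φ z * b z')) volume z]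
    have hsub := Measure.integral_comp_smul (volume : Measure (Phase n))
      (fun v => Complex.exp (Complex.I / ħ *
        (2 * (sympForm w z - sympForm w (z - v) + sympForm z (z - v)) : ℝ)) *
          (Φ z * b (z - v))) (1 / 2 : ℝ)
    rw [Complex.real_smul, ← hd] at hsub
    rw [← hsub]
    congr 1
    ext v
    congr 4
    have hzz : sympForm z z = 0 := by rw [sympForm_apply, sub_self]
    simp only [map_sub, map_smul, sub_apply, smul_eq_mul, hzz]
    ring
  ext w
  rw [conjS_apply, starTest_apply, starTest_apply, map_mul, Complex.conj_ofReal]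
  simp only [key, integral_const_mul]
  rw [map_mul, hd, Complex.conj_ofReal]
  congr 2
  have hi : Integrable (fun q : Phase n × Phase n => Complex.exp (Complex.I / ħ *
      (2 * (sympForm w q.1 - sympForm w q.2 + sympForm q.1 q.2) : ℝ)) * (Φ q.1 * b q.2))
      ((volume : Measure (Phase n)).prod volume) := by
    have h0 : Integrable Φ (volume : Measure (Phase n)) := Φ.integrable
    have h1 : Integrable b (volume : Measure (Phase n)) := b.integrable
    refine (h0.mul_prod h1).bdd_mul (c := 1) (Continuous.aestronglyMeasurable ?_)
      (.of_forall fun v => (norm_exp_I_div_mul _ _).le)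
    simp only [sympForm_apply]
    fun_prop
  refine Eq.trans ?_ (integral_integral_swap hi).symm
  rw [← integral_conj]
  congr 1
  ext z'
  rw [← integral_conj]
  congr 1
  ext z
  rw [map_mul, map_mul, conjS_apply, conjS_apply, Complex.conj_conj, Complex.conj_conj,
    ← Complex.exp_conj, mul_comm (b z')]
  congr 2
  simp only [map_mul, map_div₀, Complex.conj_I, Complex.conj_ofReal]
  rw [sympForm_swap z' z]
  push_cast
  ring

/-- The transposed form of the fact that the kernel of the formal adjoint of an operator with
kernel `K(x, y)` is `conj K(y, x)`. -/
theorem conjS_kernelTest_tensorRight (f g : 𝓢(Config n, ℂ)) :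
    conjS (kernelTest hħ (tensorRight (conjS f) (conjS g))) =
      kernelTest hħ (tensorRight g f) := by
  ext w
  rw [conjS_apply, kernelTest_apply, kernelTest_apply, map_mul, Complex.conj_ofReal,
    ← integral_neg_eq_self, ← integral_conj]
  congr 2
  ext s
  simp only [tensorRight_apply, conjS_apply, map_mul, Complex.conj_conj, ← Complex.exp_conj,
    map_div₀, Complex.conj_I, Complex.conj_ofReal, inner_neg_right, smul_neg, sub_neg_eq_add,
    ← sub_eq_add_neg]
  rw [mul_comm (f _)]
  congr 2
  push_cast
  ring

theorem moyalProduct_wavePacket (φ : 𝓢(Config n, ℂ)) (H : 𝓢'(Phase n, ℂ)) (ψ : 𝓢(Config n, ℂ)) :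
    moyalProduct hħ H (wavePacket hħ φ ψ) = wavePacketExt hħ φ (weylOperator hħ H ψ) := by
  ext Φ
  rw [moyalProduct_apply, starTest_wavePacket, wavePacketExt, dualExtension_apply,
    weylOperator_apply]

theorem wavePacketAdjointExt_moyalProduct (φ : 𝓢(Config n, ℂ)) (H : 𝓢'(Phase n, ℂ))
    (Ψ : 𝓢(Phase n, ℂ)) :
    wavePacketAdjointExt hħ φ (moyalProduct hħ H Ψ) =
      weylOperator hħ H (wavePacketAdjoint hħ φ Ψ) := by
  ext χ
  rw [wavePacketAdjointExt, dualExtension_apply, moyalProduct_apply, weylOperator_apply,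
    ← conjS_starTest_conjS, conjS_conjS, starTest_wavePacket, conjS_conjS,
    conjS_kernelTest_tensorRight]

end Intertwining

end PhaseSpace

theorem mainTheorem2 (n : ℕ) (ħ : ℝ) (hħ : 0 < ħ) (φ : 𝓢(PhaseSpace.Config n, ℂ)) :
    (∀ (z₀ : PhaseSpace.Phase n) (ψ : 𝓢(PhaseSpace.Config n, ℂ)),
      PhaseSpace.wavePacket hħ φ (PhaseSpace.heisenbergWeyl ħ z₀ ψ) =
        PhaseSpace.phaseHeisenbergWeyl ħ z₀ (PhaseSpace.wavePacket hħ φ ψ)) ∧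
    (∀ (z₀ : PhaseSpace.Phase n) (u : 𝓢'(PhaseSpace.Config n, ℂ)),
      PhaseSpace.wavePacketExt hħ φ (PhaseSpace.heisenbergWeylExt ħ z₀ u) =
        PhaseSpace.phaseHeisenbergWeylExt ħ z₀ (PhaseSpace.wavePacketExt hħ φ u)) ∧
    (∀ (H : 𝓢'(PhaseSpace.Phase n, ℂ)) (ψ : 𝓢(PhaseSpace.Config n, ℂ)),
      PhaseSpace.moyalProduct hħ H (PhaseSpace.wavePacket hħ φ ψ) =
        PhaseSpace.wavePacketExt hħ φ (PhaseSpace.weylOperator hħ H ψ)) ∧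
    (∀ (H : 𝓢'(PhaseSpace.Phase n, ℂ)) (Ψ : 𝓢(PhaseSpace.Phase n, ℂ)),
      PhaseSpace.wavePacketAdjointExt hħ φ (PhaseSpace.moyalProduct hħ H Ψ) =
        PhaseSpace.weylOperator hħ H (PhaseSpace.wavePacketAdjoint hħ φ Ψ)) :=
  ⟨fun z₀ ψ => PhaseSpace.wavePacket_heisenbergWeyl hħ φ ψ z₀,
    PhaseSpace.wavePacketExt_heisenbergWeylExt hħ φ,
    PhaseSpace.moyalProduct_wavePacket hħ φ, PhaseSpace.wavePacketAdjointExt_moyalProduct hħ φ⟩
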